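/- Let $K$ be an arbitrary field and let $q\in K$, $q\neq 1$, be a primitive $n$-th root of unity ($n\geq 1$; hence $n\geq 2$ and $q\ne 0$). Let $A_1=A_1(q)=K\langle x,y \mid xy-qyx=1\rangle$ be the quantum Weyl algebra, let $Z(A_1)$ be its centre, and put $$h=yx+\frac{1}{q-1},\qquad t=x^n,\quad r=y^n,\quad s=h^n ;$$ the elements $t,r,s$ are central. A two-sided ideal $P$ of a ring $R$ is called completely prime if $R/P$ is a domain, and ${\rm Spec}_c(R)$ denotes the set of completely prime ideals of $R$. For a subset of $A_1$, let $(\cdots)$ denote the two-sided ideal it generates. For a prime ideal $\mathfrak p$ of $Z(A_1)$ let $k(\mathfrak p)$ be the field of fractions of the domain $Z(A_1)/\mathfrak p$, let $E(s,\mathfrak p)=k(\mathfrak p)[h]/(h^n-s)$, where $s$ stands for its image in $k(\mathfrak p)$ and $h$ on the right-hand side is a polynomial variable, and let $\sigma$ be the $k(\mathfrak p)$-algebra automorphism of $E(s,\mathfrak p)$ with $\sigma(h)=qh$. For a matrix $X=(x_{ij})$ over $E(s,\mathfrak p)$ write $X^{\sigma^k}=(\sigma^k(x_{ij}))$. Let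 $a\in k(\mathfrak p)$ be the image of $t=x^n$. Then ${\rm Spec}_c(A_1)$ consists precisely of the following ideals: 1. $\{0\}$ and $(h)$; 2. $(h,f(x))$, where $f\in K[x]$ is monic and irreducible and $f\neq x$; 3. $A_1\mathfrak p$, where $\mathfrak p$ is a nonzero prime ideal of $Z(A_1)$ with $t,r,s\notin\mathfrak p$ such that $E(s,\mathfrak p)$ is a field and $$n=\min\{d'\geq 1 \mid d'\mid n \text{ and there is a matrix } X\in M_{d'}(E(s,\mathfrak p)) \text{ with } X^{\sigma^{n-1}}\cdots X^{\sigma}X=a\},$$ where $a$ on the right denotes the scalar matrix $a\cdot I_{d'}$. -/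

import Mathlib

open Polynomial

/-- The defining relation `x y - q y x = 1` on the free algebra in `x = ι 0`, `y = ι 1`. -/
inductive QuantumWeyl.Rel {K : Type*} [Field K] (q : K) :
    FreeAlgebra K (Fin 2) → FreeAlgebra K (Fin 2) → Prop
  | comm : QuantumWeyl.Rel q
      (FreeAlgebra.ι K 0 * FreeAlgebra.ι K 1 - q • (FreeAlgebra.ι K 1 * FreeAlgebra.ι K 0)) 1

/-- The quantum Weyl algebra `A₁(q) = K⟨x, y | x y - q y x = 1⟩`. -/
def QuantumWeyl {K : Type*} [Field K] (q : K) : Type _ :=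
  RingQuot (QuantumWeyl.Rel q)

namespace QuantumWeyl

variable {K : Type*} [Field K] (q : K)

noncomputable instance : Ring (QuantumWeyl q) :=
  inferInstanceAs (Ring (RingQuot (QuantumWeyl.Rel q)))

noncomputable instance : Algebra K (QuantumWeyl q) :=
  inferInstanceAs (Algebra K (RingQuot (QuantumWeyl.Rel q)))

/-- The quotient map from the free algebra. -/
noncomputable def mk : FreeAlgebra K (Fin 2) →ₐ[K] QuantumWeyl q :=
  RingQuot.mkAlgHom K (QuantumWeyl.Rel q)

/-- The generator `x`. -/
noncomputable def x : QuantumWeyl q := mk q (FreeAlgebra.ι K 0)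

/-- The generator `y`. -/
noncomputable def y : QuantumWeyl q := mk q (FreeAlgebra.ι K 1)

/-- The normal element `h = y x + 1 / (q - 1)`. -/
noncomputable def h : QuantumWeyl q :=
  y q * x q + algebraMap K (QuantumWeyl q) (1 / (q - 1))

theorem x_mul_y : x q * y q - q • (y q * x q) = 1 := by
  have e := RingQuot.mkAlgHom_rel K (Rel.comm (q := q))
  rw [map_sub, map_smul, map_mul, map_mul, map_one] at e
  exact e

theorem x_mul_y' : x q * y q = q • (y q * x q) + 1 := by
  rw [← x_mul_y q]; abel

/-- An element that commutes with `x` and `y` is central. -/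
theorem mem_center_of_comm {z : QuantumWeyl q} (hx : x q * z = z * x q)
    (hy : y q * z = z * y q) : z ∈ Subalgebra.center K (QuantumWeyl q) := by
  rw [Subalgebra.mem_center_iff]
  intro b
  obtain ⟨b, rfl⟩ := RingQuot.mkAlgHom_surjective K (QuantumWeyl.Rel q) b
  change mk q b * z = z * mk q b
  induction b using FreeAlgebra.induction with
  | grade0 r => rw [AlgHom.commutes, Algebra.commutes]
  | grade1 i => fin_cases i <;> assumption
  | mul a b ha hb => rw [map_mul, mul_assoc, hb, ← mul_assoc, ha, mul_assoc]
  | add a b ha hb => rw [map_add, add_mul, mul_add, ha, hb]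

variable {q}

theorem x_mul_h (hq1 : q ≠ 1) : x q * h q = q • (h q * x q) := by
  have hne : q - 1 ≠ 0 := sub_ne_zero.2 hq1
  have e : (1 / (q - 1) : K) = q * (1 / (q - 1)) - 1 := by field_simp; ring
  rw [h, mul_add, ← mul_assoc, x_mul_y', ← Algebra.commutes, ← Algebra.smul_def, add_mul,
    add_mul, one_mul, ← Algebra.smul_def, smul_add, smul_smul, smul_mul_assoc]
  nth_rewrite 1 [e]
  rw [sub_smul, one_smul]
  abel

theorem h_mul_y (hq1 : q ≠ 1) : h q * y q = q • (y q * h q) := by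
  have hne : q - 1 ≠ 0 := sub_ne_zero.2 hq1
  have e : (1 / (q - 1) : K) = q * (1 / (q - 1)) - 1 := by field_simp; ring
  rw [h, add_mul, mul_assoc, x_mul_y', ← Algebra.smul_def, mul_add, mul_add, mul_one,
    ← Algebra.commutes, ← Algebra.smul_def, smul_add, smul_smul, mul_smul_comm]
  nth_rewrite 1 [e]
  rw [sub_smul, one_smul]
  abel

theorem x_mul_h_pow (hq1 : q ≠ 1) (k : ℕ) : x q * h q ^ k = q ^ k • (h q ^ k * x q) := by
  induction k with
  | zero => simp
  | succ k ih =>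
    rw [pow_succ, ← mul_assoc, ih, smul_mul_assoc, mul_assoc, x_mul_h hq1, mul_smul_comm,
      smul_smul, mul_assoc, pow_succ]

theorem h_pow_mul_y (hq1 : q ≠ 1) (k : ℕ) : h q ^ k * y q = q ^ k • (y q * h q ^ k) := by
  induction k with
  | zero => simp
  | succ k ih =>
    rw [pow_succ', mul_assoc, ih, mul_smul_comm, ← mul_assoc, h_mul_y hq1, smul_mul_assoc,
      smul_smul, mul_assoc, pow_succ]

theorem x_pow_mul_y (k : ℕ) :
    x q ^ (k + 1) * y q =
      q ^ (k + 1) • (y q * x q ^ (k + 1)) + (∑ i ∈ Finset.range (k + 1), q ^ i) • x q ^ k := by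
  induction k with
  | zero => simp [x_mul_y']
  | succ k ih =>
    rw [pow_succ' (x q) (k + 1), mul_assoc, ih, mul_add, mul_smul_comm, mul_smul_comm,
      ← mul_assoc (x q) (y q), x_mul_y', add_mul, one_mul, smul_mul_assoc, smul_add, smul_smul,
      ← pow_succ, ← pow_succ', Finset.sum_range_succ _ (k + 1), add_smul, mul_assoc, ← pow_succ']
    abel

theorem x_pow_mem_center {n : ℕ} (hq1 : q ≠ 1) (hq : IsPrimitiveRoot q n) :
    x q ^ n ∈ Subalgebra.center K (QuantumWeyl q) := by
  refine mem_center_of_comm q (by rw [← pow_succ, ← pow_succ']) ?_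
  rcases n with _ | k
  · simp
  · have hs : ∑ i ∈ Finset.range (k + 1), q ^ i = 0 := by
      have hm := geom_sum_mul q (k + 1)
      rw [hq.pow_eq_one, sub_self] at hm
      exact (mul_eq_zero.1 hm).resolve_right (sub_ne_zero.2 hq1)
    rw [x_pow_mul_y, hs, hq.pow_eq_one, one_smul, zero_smul, add_zero]

theorem x_mul_y_pow (k : ℕ) :
    x q * y q ^ (k + 1) =
      q ^ (k + 1) • (y q ^ (k + 1) * x q) + (∑ i ∈ Finset.range (k + 1), q ^ i) • y q ^ k := by
  induction k with
  | zero => simp [x_mul_y']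
  | succ k ih =>
    rw [pow_succ (y q) (k + 1), ← mul_assoc, ih, add_mul, smul_mul_assoc, smul_mul_assoc,
      mul_assoc _ (x q) (y q), x_mul_y', mul_add, mul_one, mul_smul_comm, smul_add, smul_smul,
      ← pow_succ, ← pow_succ, Finset.sum_range_succ _ (k + 1), add_smul, ← mul_assoc, ← pow_succ]
    abel

theorem y_pow_mem_center {n : ℕ} (hq1 : q ≠ 1) (hq : IsPrimitiveRoot q n) :
    y q ^ n ∈ Subalgebra.center K (QuantumWeyl q) := by
  refine mem_center_of_comm q ?_ (by rw [← pow_succ, ← pow_succ'])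
  rcases n with _ | k
  · simp
  · have hs : ∑ i ∈ Finset.range (k + 1), q ^ i = 0 := by
      have hm := geom_sum_mul q (k + 1)
      rw [hq.pow_eq_one, sub_self] at hm
      exact (mul_eq_zero.1 hm).resolve_right (sub_ne_zero.2 hq1)
    rw [x_mul_y_pow, hs, hq.pow_eq_one, one_smul, zero_smul, add_zero]

theorem h_pow_mem_center {n : ℕ} (hq1 : q ≠ 1) (hq : IsPrimitiveRoot q n) :
    h q ^ n ∈ Subalgebra.center K (QuantumWeyl q) := by
  refine mem_center_of_comm q ?_ ?_
  · rw [x_mul_h_pow hq1, hq.pow_eq_one, one_smul]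
  · rw [h_pow_mul_y hq1, hq.pow_eq_one, one_smul]

variable (q)

/-- The centre `Z(A₁)`. -/
abbrev Z : Type _ := ↥(Subalgebra.center K (QuantumWeyl q))

variable {q}

/-- The central element `t = xⁿ`. -/
noncomputable def t {n : ℕ} (hq1 : q ≠ 1) (hq : IsPrimitiveRoot q n) : Z q :=
  ⟨x q ^ n, x_pow_mem_center hq1 hq⟩

/-- The central element `r = yⁿ`. -/
noncomputable def r {n : ℕ} (hq1 : q ≠ 1) (hq : IsPrimitiveRoot q n) : Z q :=
  ⟨y q ^ n, y_pow_mem_center hq1 hq⟩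

/-- The central element `s = hⁿ`. -/
noncomputable def s {n : ℕ} (hq1 : q ≠ 1) (hq : IsPrimitiveRoot q n) : Z q :=
  ⟨h q ^ n, h_pow_mem_center hq1 hq⟩

/-- The left ideal `A₁ 𝔭` generated by an ideal `𝔭` of the centre. -/
noncomputable def extLeft (p : Ideal (Z q)) : Ideal (QuantumWeyl q) :=
  p.map (Subalgebra.center K (QuantumWeyl q)).val

instance extLeft_isTwoSided (p : Ideal (Z q)) : (extLeft p).IsTwoSided where
  mul_mem_of_left b ha := by
    unfold extLeft Ideal.map at ha ⊢
    induction ha using Submodule.span_induction with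
    | mem z hz =>
      obtain ⟨z, hz, rfl⟩ := hz
      have e : z.1 * b = b * z.1 := (Subalgebra.mem_center_iff.1 z.2 b).symm
      change z.1 * b ∈ _
      rw [e]
      exact Ideal.mul_mem_left _ _ (Ideal.subset_span ⟨z, hz, rfl⟩)
    | zero => rw [zero_mul]; exact Ideal.zero_mem _
    | add u v _ _ hu hv => rw [add_mul]; exact Ideal.add_mem _ hu hv
    | smul c u _ hu => rw [smul_eq_mul, mul_assoc]; exact Ideal.mul_mem_left _ _ hu

/-- The ideal `A₁ 𝔭`, which is two-sided because `𝔭` is central. -/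
noncomputable def ext (p : Ideal (Z q)) : TwoSidedIdeal (QuantumWeyl q) :=
  (extLeft p).toTwoSided

/-- `k(𝔭)`: the field of fractions of `Z(A₁) / 𝔭`. -/
abbrev k (p : Ideal (Z q)) : Type _ := FractionRing (Z q ⧸ p)

/-- The image in `k(𝔭)` of a central element. -/
noncomputable def toK (p : Ideal (Z q)) (z : Z q) : k p :=
  algebraMap (Z q ⧸ p) (k p) (Ideal.Quotient.mk p z)

end QuantumWeyl

/-- A two-sided ideal `P` is completely prime if `R / P` is a domain
(such a `P` is in particular a proper prime ideal). -/
def TwoSidedIdeal.IsCompletelyPrime {R : Type*} [Ring R] (P : TwoSidedIdeal R) : Prop :=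
  IsDomain P.ringCon.Quotient

/-- The completely prime spectrum of a ring. -/
def completelyPrimeSpectrum (R : Type*) [Ring R] : Set (TwoSidedIdeal R) :=
  {P | P.IsCompletelyPrime}

/-- `E(s) = F[h] / (hⁿ - s)`. -/
abbrev KummerAlg {F : Type*} [CommRing F] (n : ℕ) (s : F) : Type _ :=
  AdjoinRoot (X ^ n - C s : F[X])

/-- The `F`-algebra map `σ` on `E(s)` with `σ(h) = q h`, where `qⁿ = 1`. -/
noncomputable def KummerAlg.sigma {F : Type*} [CommRing F] {n : ℕ} (s : F) {q : F}
    (hq : q ^ n = 1) : KummerAlg n s →ₐ[F] KummerAlg n s :=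
  AdjoinRoot.liftAlgHom (X ^ n - C s) (Algebra.ofId F (KummerAlg n s))
    (algebraMap F (KummerAlg n s) q * AdjoinRoot.root (X ^ n - C s)) (by
      have e : (AdjoinRoot.root (X ^ n - C s)) ^ n = AdjoinRoot.of (X ^ n - C s) s := by
        have := AdjoinRoot.eval₂_root (X ^ n - C s)
        rwa [eval₂_sub, eval₂_X_pow, eval₂_C, sub_eq_zero] at this
      rw [eval₂_sub, eval₂_X_pow, eval₂_C, mul_pow, ← map_pow, hq, map_one, one_mul, e]
      exact sub_self _)

theorem KummerAlg.sigma_root {F : Type*} [CommRing F] {n : ℕ} (s : F) {q : F}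
    (hq : q ^ n = 1) :
    KummerAlg.sigma s hq (AdjoinRoot.root (X ^ n - C s)) =
      algebraMap F (KummerAlg n s) q * AdjoinRoot.root (X ^ n - C s) :=
  AdjoinRoot.liftAlgHom_root ..

/-- `σⁿ = 1`, so that `σ` is an automorphism. -/
theorem KummerAlg.sigma_pow {F : Type*} [CommRing F] {n : ℕ} (s : F) {q : F}
    (hq : q ^ n = 1) : KummerAlg.sigma s hq ^ n = 1 := by
  have key : ∀ k : ℕ, (KummerAlg.sigma s hq ^ k) (AdjoinRoot.root (X ^ n - C s)) =
      algebraMap F (KummerAlg n s) (q ^ k) * AdjoinRoot.root (X ^ n - C s) := by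
    intro k
    induction k with
    | zero => simp
    | succ k ih =>
      rw [pow_succ, AlgHom.mul_apply, KummerAlg.sigma_root, map_mul, AlgHom.commutes, ih,
        ← mul_assoc, ← map_mul, pow_succ']
  apply AdjoinRoot.algHom_ext
  rw [key, hq, map_one, one_mul, AlgHom.one_apply]

/-- The matrix `(σ, i)`-norm `Y^{σ^{i-1}} ⋯ Y^σ Y`, where `σ` acts on matrices entrywise. -/
def matrixSigmaNorm {E : Type*} [CommRing E] (σ : E → E) {d : ℕ} (Y : Matrix (Fin d) (Fin d) E) :
    ℕ → Matrix (Fin d) (Fin d) E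
  | 0 => 1
  | i + 1 => Y.map σ^[i] * matrixSigmaNorm σ Y i

namespace QuantumWeyl

variable {K : Type*} [Field K] {q : K}

/-- `E(s, 𝔭) = k(𝔭)[h] / (hⁿ - s)`. -/
abbrev E {n : ℕ} (hq1 : q ≠ 1) (hq : IsPrimitiveRoot q n) (p : Ideal (Z q)) : Type _ :=
  KummerAlg n (toK p (s hq1 hq))

/-- The automorphism `σ` of `E(s, 𝔭)` over `k(𝔭)` with `σ(h) = q h`. -/
noncomputable def sigma {n : ℕ} (hq1 : q ≠ 1) (hq : IsPrimitiveRoot q n) (p : Ideal (Z q)) :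
    E hq1 hq p →ₐ[k p] E hq1 hq p :=
  KummerAlg.sigma (toK p (s hq1 hq)) (q := algebraMap K (k p) q)
    (by rw [← map_pow, hq.pow_eq_one, map_one])

/-- The divisors `d'` of `n` for which some `X ∈ M_{d'}(E(s, 𝔭))` satisfies
`X^{σ^{n-1}} ⋯ X^σ X = a`, where `a` is the (scalar matrix of the) image of `t = xⁿ` in `k(𝔭)`. -/
def normDivisors {n : ℕ} (hq1 : q ≠ 1) (hq : IsPrimitiveRoot q n) (p : Ideal (Z q)) : Set ℕ :=
  {d | 1 ≤ d ∧ d ∣ n ∧ ∃ X : Matrix (Fin d) (Fin d) (E hq1 hq p),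
    matrixSigmaNorm (sigma hq1 hq p) X n =
      algebraMap (k p) (Matrix (Fin d) (Fin d) (E hq1 hq p)) (toK p (t hq1 hq))}

end QuantumWeyl

/-! A completely prime ideal P either contains h or it does not. Modulo h the products xy and yx
both equal the nonzero scalar -1/(q-1), so A₁/(h) is the Laurent polynomial ring in x. Its primes
are 0 and (f) with f monic irreducible and f ≠ x; this gives all P containing h
(`eq_span_of_h_mem`).

If h ∉ P, put 𝔭 = P ∩ Z(A₁). The defining relation keeps x and y out of P, so t, r, s ∉ 𝔭. The fibre
D = k(𝔭) ⊗ A₁ over Z(A₁) is then generated by x and h with xh = qhx and with xⁿ, hⁿ equal to nonzero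
scalars: a cyclic algebra. Conjugation by x and by h separates the monomials hⁱxʲ, so D has
dimension n² and is simple (`IsCyclicPair.isSimpleRing`). Simplicity forces P = A₁𝔭
(`eq_ext_of_isCompletelyPrime`). The coordinates of A₁ over its centre identify the kernel of A₁ → D
with A₁𝔭, and clearing denominators shows that A₁𝔭 is completely prime exactly when D has no zero
divisors (`ext_isCompletelyPrime_iff`).

It remains to decide when D is a division algebra (`IsCyclicPair.noZeroDivisors_iff`). Its
commutative subalgebra E = F[h] must be a field. A D-module of dimension d over E is E^d with a
σ-semilinear operator x satisfying xⁿ = a, that is, a d × d matrix with σ-norm a. Since D has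
dimension n over E and is a power of its simple module, D is a division algebra exactly when no such
matrix has size a smaller divisor of n. -/

/-! ### Cyclic algebras: monomial basis and simplicity. -/

section CyclicAlgebra

variable {F D : Type*} [Field F] [Ring D] [Algebra F D]

/-- The relations of the cyclic algebra `(F[h]/(hⁿ - s), σ, a)` with `σ h = q h`. -/
structure IsCyclicPair (q a s : F) (n : ℕ) (x h : D) : Prop where
  comm : x * h = q • (h * x)
  x_pow : x ^ n = algebraMap F D a
  h_pow : h ^ n = algebraMap F D s

theorem TwoSidedIdeal.smul_mem_of_mem (I : TwoSidedIdeal D) (c : F) {d : D} (hd : d ∈ I) :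
    c • d ∈ I := by
  rw [Algebra.smul_def]; exact I.mul_mem_left _ _ hd

theorem TwoSidedIdeal.mem_of_smul_mem (I : TwoSidedIdeal D) {c : F} (hc : c ≠ 0) {d : D}
    (hd : c • d ∈ I) : d ∈ I := by
  simpa [smul_smul, inv_mul_cancel₀ hc] using I.smul_mem_of_mem c⁻¹ hd

theorem pow_mul_eq_smul_mul_pow {q : F} {g d : D} (hd : g * d = q • (d * g)) (u : ℕ) :
    g ^ u * d = q ^ u • (d * g ^ u) := by
  induction u with
  | zero => simp
  | succ u ih =>
    rw [pow_succ, mul_assoc, hd, mul_smul_comm, ← mul_assoc, ih, smul_mul_assoc, smul_smul,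
      mul_assoc, ← pow_succ']

theorem mul_pow_eq_smul_pow_mul {q : F} {g d : D} (hd : g * d = q • (d * g)) (u : ℕ) :
    g * d ^ u = q ^ u • (d ^ u * g) := by
  induction u with
  | zero => simp
  | succ u ih =>
    rw [pow_succ, ← mul_assoc, ih, smul_mul_assoc, mul_assoc, hd, mul_smul_comm, smul_smul,
      ← mul_assoc, ← pow_succ]

/-- Orthogonality of the characters of ℤ/n; the exponent (n - k)u plays the role of -ku. -/
theorem IsPrimitiveRoot.sum_pow_shift {q : F} {n : ℕ} (hq : IsPrimitiveRoot q n) {i k : ℕ}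
    (hi : i < n) (hk : k < n) :
    ∑ u ∈ Finset.range n, q ^ ((n - k) * u) * (q ^ i) ^ u = if i = k then (n : F) else 0 := by
  have e : ∀ u, q ^ ((n - k) * u) * (q ^ i) ^ u = (q ^ (n - k + i)) ^ u := fun u => by
    rw [pow_mul, ← mul_pow, ← pow_add]
  simp_rw [e]
  split_ifs with h
  · subst h
    rw [Nat.sub_add_cancel hi.le, hq.pow_eq_one]; simp
  · have h1 : q ^ (n - k + i) ≠ 1 := by
      intro h1
      have h2 := (hq.pow_eq_one_iff_dvd _).1 h1
      obtain ⟨m, hm⟩ := h2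
      -- The exponent n - k + i lies strictly between 0 and n if i < k, and strictly between n and
      -- 2n if i > k, so it is not a multiple of n.
      rcases lt_or_gt_of_ne h with hlt | hlt
      · have : m < 1 := by
          by_contra! hm1
          have := Nat.mul_le_mul_left n hm1
          omega
        interval_cases m
        omega
      · have h3 : m < 2 := by
          by_contra! hm1
          have := Nat.mul_le_mul_left n hm1
          omega
        interval_cases m <;> omega
    have h2 := geom_sum_mul (q ^ (n - k + i)) n
    rw [← pow_mul, mul_comm _ n, pow_mul, hq.pow_eq_one, one_pow, sub_self] at h2
    exact (mul_eq_zero.1 h2).resolve_right (sub_ne_zero.2 h1)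

/-- The components of an element of a two-sided ideal with respect to the eigenspaces of the
conjugation by `g` lie in the ideal. -/
theorem TwoSidedIdeal.eigencomponent_mem {q : F} {n : ℕ} (hn : 0 < n) (hq : IsPrimitiveRoot q n)
    (I : TwoSidedIdeal D) {g : D} {c : F} (hc : c ≠ 0) (hg : g ^ n = algebraMap F D c)
    (d : ℕ → D) (hd : ∀ i, g * d i = q ^ i • (d i * g)) (hI : ∑ i ∈ Finset.range n, d i ∈ I)
    {k : ℕ} (hk : k < n) : d k ∈ I := by
  -- The projector onto the qᵏ-eigenspace averages the conjugates gᵘ d g⁻ᵘ with weights q⁻ᵏᵘ.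
  -- Writing gⁿ⁻ᵘ for g⁻ᵘ costs the factor gⁿ = c, hence the scalar n · c.
  have key : ∑ u ∈ Finset.range n,
      q ^ ((n - k) * u) • (g ^ u * (∑ i ∈ Finset.range n, d i) * g ^ (n - u)) =
      ((n : F) * c) • d k := by
    have e : ∀ u ∈ Finset.range n,
        q ^ ((n - k) * u) • (g ^ u * (∑ i ∈ Finset.range n, d i) * g ^ (n - u)) =
        ∑ i ∈ Finset.range n, (q ^ ((n - k) * u) * (q ^ i) ^ u) • (d i * g ^ n) := by
      intro u hu
      rw [Finset.mul_sum, Finset.sum_mul, Finset.smul_sum]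
      refine Finset.sum_congr rfl fun i _ => ?_
      rw [pow_mul_eq_smul_mul_pow (hd i), smul_mul_assoc, smul_smul, mul_assoc, ← pow_add,
        Nat.add_sub_cancel' (Finset.mem_range.1 hu).le]
    rw [Finset.sum_congr rfl e, Finset.sum_comm]
    have e2 : ∀ i ∈ Finset.range n, ∑ u ∈ Finset.range n,
        (q ^ ((n - k) * u) * (q ^ i) ^ u) • (d i * g ^ n) =
        if i = k then (n : F) • (d i * g ^ n) else 0 := by
      intro i hi
      rw [← Finset.sum_smul, hq.sum_pow_shift (Finset.mem_range.1 hi) hk]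
      split_ifs <;> simp
    rw [Finset.sum_congr rfl e2, Finset.sum_ite_eq' _ k, if_pos (Finset.mem_range.2 hk), hg,
      ← Algebra.commutes, ← Algebra.smul_def, smul_smul]
  have : NeZero n := ⟨hn.ne'⟩
  -- A field with a primitive n-th root of unity has characteristic prime to n.
  have hn0 : (n : F) ≠ 0 := (hq.neZero' (R := F)).out
  refine I.mem_of_smul_mem (mul_ne_zero hn0 hc) (key ▸ I.finsetSum_mem _ _ fun u _ => ?_)
  exact I.smul_mem_of_mem _ (I.mul_mem_right _ _ (I.mul_mem_left _ _ hI))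

namespace IsCyclicPair

variable {q a s : F} {n : ℕ} {x h : D}

theorem h_mul_x (P : IsCyclicPair q a s n x h) (hq0 : q ≠ 0) : h * x = q⁻¹ • (x * h) := by
  rw [P.comm, smul_smul, inv_mul_cancel₀ hq0, one_smul]

/-- Conjugation by x isolates the power of h (eigenvalue qⁱ), then conjugation by h isolates the
power of x (eigenvalue q⁻ʲ), so each single term lies in I. Monomials are units, hence the
coefficients vanish. The case I = ⊥ gives linear independence, a general proper I gives simplicity.
-/
theorem coeff_eq_zero_of_sum_mem (P : IsCyclicPair q a s n x h) (hn : 0 < n)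
    (hq : IsPrimitiveRoot q n) (ha : a ≠ 0) (hs : s ≠ 0) (I : TwoSidedIdeal D) (hI : (1 : D) ∉ I)
    (c : ℕ → ℕ → F)
    (hc : ∑ i ∈ Finset.range n, ∑ j ∈ Finset.range n, c i j • (h ^ i * x ^ j) ∈ I)
    {i j : ℕ} (hi : i < n) (hj : j < n) : c i j = 0 := by
  have hq0 : q ≠ 0 := hq.ne_zero hn.ne'
  have h1 : ∑ j ∈ Finset.range n, c i j • (h ^ i * x ^ j) ∈ I := by
    refine I.eigencomponent_mem hn hq ha P.x_pow
      (fun i => ∑ j ∈ Finset.range n, c i j • (h ^ i * x ^ j)) (fun i => ?_) hc hi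
    rw [Finset.mul_sum, Finset.sum_mul, Finset.smul_sum]
    refine Finset.sum_congr rfl fun j _ => ?_
    rw [mul_smul_comm, ← mul_assoc, mul_pow_eq_smul_pow_mul P.comm, smul_mul_assoc,
      smul_mul_assoc, smul_comm, mul_assoc, mul_assoc, ← pow_succ, ← pow_succ']
  have h2 : c i j • (h ^ i * x ^ j) ∈ I := by
    refine I.eigencomponent_mem hn hq.inv hs P.h_pow
      (fun j => c i j • (h ^ i * x ^ j)) (fun j => ?_) h1 hj
    rw [mul_smul_comm, ← mul_assoc, ← pow_succ', smul_mul_assoc, smul_comm]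
    congr 1
    rw [pow_succ, mul_assoc, mul_pow_eq_smul_pow_mul (P.h_mul_x hq0), mul_smul_comm, mul_assoc]
  by_contra h0
  have h3 := I.mem_of_smul_mem h0 h2
  -- Completing the monomial to hⁿxⁿ puts the nonzero scalar s · a into I.
  have h4 := I.mul_mem_left (h ^ (n - i)) _ (I.mul_mem_right _ (x ^ (n - j)) h3)
  rw [mul_assoc, ← pow_add, ← mul_assoc, ← pow_add, Nat.sub_add_cancel hi.le,
    Nat.add_sub_cancel' hj.le, P.x_pow, P.h_pow, ← map_mul, Algebra.algebraMap_eq_smul_one] at h4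
  exact hI (I.mem_of_smul_mem (mul_ne_zero hs ha) h4)

theorem linearIndependent (P : IsCyclicPair q a s n x h) (hn : 0 < n)
    (hq : IsPrimitiveRoot q n) (ha : a ≠ 0) (hs : s ≠ 0) [Nontrivial D] :
    LinearIndependent F fun ij : Fin n × Fin n => h ^ (ij.1 : ℕ) * x ^ (ij.2 : ℕ) := by
  rw [Fintype.linearIndependent_iff]
  rintro g hg ⟨i, j⟩
  set c : ℕ → ℕ → F := fun i j => if hij : i < n ∧ j < n then g (⟨i, hij.1⟩, ⟨j, hij.2⟩) else 0
    with hc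
  have := P.coeff_eq_zero_of_sum_mem hn hq ha hs ⊥ (by simp [TwoSidedIdeal.mem_bot]) c (by
    rw [TwoSidedIdeal.mem_bot, Finset.sum_range]
    simp_rw [Finset.sum_range]
    rw [Fintype.sum_prod_type] at hg
    simpa [hc] using hg) i.2 j.2
  simpa [hc] using this

/-- The relation xh = qhx turns every word in x and h into a scalar multiple of some hⁱxʲ, and hⁿ =
s, xⁿ = a reduce the exponents modulo n. -/
theorem span_eq_top (P : IsCyclicPair q a s n x h) (hn : 0 < n)
    (hgen : Algebra.adjoin F {x, h} = ⊤) :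
    Submodule.span F (Set.range fun ij : Fin n × Fin n => h ^ (ij.1 : ℕ) * x ^ (ij.2 : ℕ)) = ⊤ := by
  set S := Submodule.span F
    (Set.range fun ij : Fin n × Fin n => h ^ (ij.1 : ℕ) * x ^ (ij.2 : ℕ)) with hS
  have hmem : ∀ i j : ℕ, h ^ i * x ^ j ∈ S := by
    intro i j
    have e : h ^ i * x ^ j = (s ^ (i / n) * a ^ (j / n)) • (h ^ (i % n) * x ^ (j % n)) := by
      conv_lhs => rw [← Nat.div_add_mod i n, ← Nat.div_add_mod j n]
      rw [pow_add, pow_add, pow_mul, pow_mul, P.x_pow, P.h_pow, ← map_pow, ← map_pow,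
        ← Algebra.smul_def, ← Algebra.smul_def, smul_mul_smul_comm]
    rw [e]
    exact S.smul_mem _ (Submodule.subset_span
      ⟨(⟨i % n, Nat.mod_lt _ hn⟩, ⟨j % n, Nat.mod_lt _ hn⟩), rfl⟩)
  rw [eq_top_iff, ← Algebra.top_toSubmodule, ← hgen, Algebra.adjoin_eq_span, Submodule.span_le]
  intro d hd
  suffices H : ∃ (c : F) (i j : ℕ), d = c • (h ^ i * x ^ j) by
    obtain ⟨c, i, j, rfl⟩ := H
    exact S.smul_mem _ (hmem i j)
  induction hd using Submonoid.closure_induction_left with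
  | one => exact ⟨1, 0, 0, by simp⟩
  | mul_left u hu v _ ih =>
    obtain ⟨c, i, j, rfl⟩ := ih
    rcases hu with rfl | rfl
    · refine ⟨c * q ^ i, i, j + 1, ?_⟩
      rw [mul_smul_comm, ← mul_assoc, mul_pow_eq_smul_pow_mul P.comm, smul_mul_assoc, smul_smul,
        mul_assoc, ← pow_succ']
    · exact ⟨c, i + 1, j, by rw [mul_smul_comm, ← mul_assoc, ← pow_succ']⟩

/-- The monomial basis of a cyclic algebra. -/
noncomputable def basis (P : IsCyclicPair q a s n x h) (hn : 0 < n)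
    (hq : IsPrimitiveRoot q n) (ha : a ≠ 0) (hs : s ≠ 0) [Nontrivial D]
    (hgen : Algebra.adjoin F {x, h} = ⊤) : Module.Basis (Fin n × Fin n) F D :=
  Module.Basis.mk (P.linearIndependent hn hq ha hs) (P.span_eq_top hn hgen).ge

theorem finite (P : IsCyclicPair q a s n x h) (hn : 0 < n)
    (hgen : Algebra.adjoin F {x, h} = ⊤) : Module.Finite F D :=
  ⟨(P.span_eq_top hn hgen) ▸ Submodule.fg_span (Set.finite_range _)⟩

theorem finrank (P : IsCyclicPair q a s n x h) (hn : 0 < n)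
    (hq : IsPrimitiveRoot q n) (ha : a ≠ 0) (hs : s ≠ 0) [Nontrivial D]
    (hgen : Algebra.adjoin F {x, h} = ⊤) : Module.finrank F D = n * n := by
  rw [Module.finrank_eq_card_basis (P.basis hn hq ha hs hgen)]; simp

theorem isSimpleRing (P : IsCyclicPair q a s n x h) (hn : 0 < n)
    (hq : IsPrimitiveRoot q n) (ha : a ≠ 0) (hs : s ≠ 0) [Nontrivial D]
    (hgen : Algebra.adjoin F {x, h} = ⊤) : IsSimpleRing D := by
  refine ⟨⟨fun I => ?_⟩⟩
  by_cases hI : (1 : D) ∈ I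
  · exact Or.inr ((TwoSidedIdeal.one_mem_iff I).1 hI)
  · refine Or.inl ?_
    rw [eq_bot_iff]
    intro d hd
    rw [TwoSidedIdeal.mem_bot]
    set b := P.basis hn hq ha hs hgen
    have e := b.sum_repr d
    rw [Fintype.sum_prod_type] at e
    set c : ℕ → ℕ → F := fun i j =>
      if hij : i < n ∧ j < n then b.repr d (⟨i, hij.1⟩, ⟨j, hij.2⟩) else 0 with hc
    have hcz := fun i j : Fin n => P.coeff_eq_zero_of_sum_mem hn hq ha hs I hI c (by
      rw [Finset.sum_range]
      simp_rw [Finset.sum_range]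
      rw [← e] at hd
      simpa [hc, b, basis] using hd) i.2 j.2
    rw [← e]
    refine Finset.sum_eq_zero fun i _ => Finset.sum_eq_zero fun j _ => ?_
    have := hcz i j
    simp only [hc, i.2, j.2, and_self, dite_true] at this
    rw [this, zero_smul]

end IsCyclicPair
end CyclicAlgebra

/-! ### Semilinear operators and σ-norms of matrices. -/

section SigmaNorm

variable {E : Type*} [CommRing E]

/-- The definition splits off the leftmost factor. Applying a semilinear map once more instead
twists the product already built and appends Y on the right. -/
theorem matrixSigmaNorm_succ' (σ : E →+* E) {d : ℕ} (Y : Matrix (Fin d) (Fin d) E) (i : ℕ) :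
    matrixSigmaNorm σ Y (i + 1) = (matrixSigmaNorm σ Y i).map σ * Y := by
  induction i with
  | zero => ext; simp [matrixSigmaNorm, Matrix.mul_apply, Matrix.one_apply]
  | succ i ih =>
    have e : matrixSigmaNorm σ Y (i + 1) = Y.map σ^[i] * matrixSigmaNorm σ Y i := rfl
    rw [show matrixSigmaNorm σ Y (i + 1 + 1) = Y.map σ^[i + 1] * matrixSigmaNorm σ Y (i + 1) from rfl,
      ih, ← mul_assoc]
    congr 1
    rw [← ih, e, Matrix.map_mul, Matrix.map_map, Function.iterate_succ']

/-- The matrix of the iterates of a semilinear map. -/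
theorem iterate_semilinear_basis {V : Type*} [AddCommGroup V] [Module E V] {σ : E →+* E}
    (φ : V →ₛₗ[σ] V) {d : ℕ} (b : Module.Basis (Fin d) E V) (k : ℕ) (j : Fin d) :
    φ^[k] (b j) = ∑ i, matrixSigmaNorm σ (Matrix.of fun i l => b.repr (φ (b i)) l) k j i • b i := by
  induction k with
  | zero => simp [matrixSigmaNorm, Matrix.one_apply]
  | succ k ih =>
    rw [Function.iterate_succ', Function.comp_apply, ih, map_sum, matrixSigmaNorm_succ']
    simp_rw [map_smulₛₗ, Matrix.mul_apply, Finset.sum_smul]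
    rw [Finset.sum_comm]
    refine Finset.sum_congr rfl fun i _ => ?_
    conv_lhs => rw [← b.sum_repr (φ (b i))]
    simp_rw [Finset.smul_sum, smul_smul, Matrix.map_apply, Matrix.of_apply]

/-- The rows of X are the images of the basis vectors under φ; the matrix of the n-th iterate is
then the norm of X. -/
theorem exists_matrixSigmaNorm_eq {V : Type*} [AddCommGroup V] [Module E V] {σ : E →+* E}
    (φ : V →ₛₗ[σ] V) {d : ℕ} (b : Module.Basis (Fin d) E V) {n : ℕ} {a : E}
    (hφ : ∀ v, φ^[n] v = a • v) :
    ∃ X : Matrix (Fin d) (Fin d) E, matrixSigmaNorm σ X n = algebraMap E _ a := by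
  refine ⟨Matrix.of fun i l => b.repr (φ (b i)) l, ?_⟩
  ext j i
  have h1 := iterate_semilinear_basis φ b n j
  rw [hφ] at h1
  have h2 := congrArg (fun v => b.repr v i) h1
  simp only [map_smul, map_sum, Finsupp.smul_apply, Finsupp.finsetSum_apply,
    Module.Basis.repr_self, Finsupp.single_apply, smul_eq_mul, mul_ite, mul_one, mul_zero,
    Finset.sum_ite_eq', Finset.mem_univ, if_true] at h2
  rw [← h2, Matrix.algebraMap_matrix_apply]
  simp

/-- The semilinear operator on row vectors defined by a matrix, iterated. -/
theorem iterate_semilinear_vecMul (σ : E →+* E) {d : ℕ} (X : Matrix (Fin d) (Fin d) E) (k : ℕ)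
    (v : Fin d → E) :
    (fun v : Fin d → E => Matrix.vecMul (σ ∘ v) X)^[k] v =
      Matrix.vecMul (σ^[k] ∘ v) (matrixSigmaNorm σ X k) := by
  induction k with
  | zero => simp [matrixSigmaNorm]
  | succ k ih =>
    rw [Function.iterate_succ', Function.comp_apply, ih, matrixSigmaNorm_succ',
      ← Matrix.vecMul_vecMul]
    congr 1
    ext i
    simp [Matrix.vecMul, dotProduct, ← Function.iterate_succ_apply', Function.iterate_succ_apply]

end SigmaNorm

/-! ### The commutative algebra F[h]/(hⁿ - s). -/

namespace KummerAlg

variable {F : Type*} [Field F] {n : ℕ} {s q : F}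

theorem root_pow : (AdjoinRoot.root (X ^ n - C s)) ^ n = algebraMap F (KummerAlg n s) s := by
  have := AdjoinRoot.eval₂_root (X ^ n - C s)
  rwa [eval₂_sub, eval₂_X_pow, eval₂_C, sub_eq_zero] at this

/-- The power basis of `F[h] / (hⁿ - s)`. -/
noncomputable def powerBasis (hn : n ≠ 0) (s : F) : PowerBasis F (KummerAlg n s) :=
  AdjoinRoot.powerBasis' (monic_X_pow_sub_C s hn)

theorem powerBasis_dim (hn : n ≠ 0) : (powerBasis hn s).dim = n :=
  natDegree_X_pow_sub_C

theorem powerBasis_gen (hn : n ≠ 0) :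
    (powerBasis hn s).gen = AdjoinRoot.root (X ^ n - C s) := rfl

theorem finrank (hn : n ≠ 0) : Module.finrank F (KummerAlg n s) = n := by
  rw [(powerBasis hn s).finrank, powerBasis_dim]

theorem finite (hn : n ≠ 0) : Module.Finite F (KummerAlg n s) := (powerBasis hn s).finite

theorem sigma_iterate (hq : q ^ n = 1) (e : KummerAlg n s) : (sigma s hq)^[n] e = e := by
  rw [← AlgHom.coe_pow, sigma_pow, AlgHom.one_apply]

end KummerAlg

/-! ### A cyclic algebra over its subalgebra F[h]. -/

namespace IsCyclicPair

variable {F D : Type*} [Field F] [Ring D] [Algebra F D] {q a s : F} {n : ℕ} {x h : D}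

/-- The subalgebra `F[h]` of a cyclic algebra as an image of `F[h] / (hⁿ - s)`. -/
noncomputable def ofKummer (P : IsCyclicPair q a s n x h) : KummerAlg n s →ₐ[F] D :=
  Ideal.Quotient.liftₐ (Ideal.span {(X ^ n - C s : F[X])}) (aeval h) (by
    intro p hp
    obtain ⟨p, rfl⟩ := Ideal.mem_span_singleton.1 hp
    rw [map_mul, map_sub, map_pow, aeval_X, aeval_C, P.h_pow, sub_self, zero_mul])

theorem ofKummer_root (P : IsCyclicPair q a s n x h) :
    P.ofKummer (AdjoinRoot.root (X ^ n - C s)) = h :=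
  (Ideal.Quotient.liftₐ_apply _ _ _ _).trans (aeval_X h)

/-- This makes x act σ-semilinearly over E(s) on every module over the cyclic algebra. -/
theorem x_mul_ofKummer (P : IsCyclicPair q a s n x h) (hq : q ^ n = 1) (e : KummerAlg n s) :
    x * P.ofKummer e = P.ofKummer (KummerAlg.sigma s hq e) * x := by
  induction e using AdjoinRoot.induction_on with | ih p =>
  induction p using Polynomial.induction_on' with
  | add p r hp hr => simp only [map_add, mul_add, add_mul, hp, hr]
  | monomial k c =>
    rw [← C_mul_X_pow_eq_monomial]
    have e1 : AdjoinRoot.mk (X ^ n - C s) (C c * X ^ k) =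
        algebraMap F (KummerAlg n s) c * AdjoinRoot.root (X ^ n - C s) ^ k := by
      rw [map_mul, map_pow, AdjoinRoot.mk_C, AdjoinRoot.mk_X]; rfl
    rw [e1, map_mul, map_mul, map_pow, map_pow, AlgHom.commutes, AlgHom.commutes, map_mul, map_pow,
      AlgHom.commutes, KummerAlg.sigma_root, map_mul, AlgHom.commutes, P.ofKummer_root,
      ← Algebra.smul_def, ← Algebra.smul_def, ← Algebra.smul_def, mul_smul_comm,
      mul_pow_eq_smul_pow_mul P.comm, _root_.smul_pow, smul_mul_assoc, smul_mul_assoc]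

/-- The power basis goes to the monomials hⁱx⁰, which are independent. -/
theorem ofKummer_injective (P : IsCyclicPair q a s n x h) (hn : 0 < n)
    (hq : IsPrimitiveRoot q n) (ha : a ≠ 0) (hs : s ≠ 0) [Nontrivial D] :
    Function.Injective P.ofKummer := by
  rw [injective_iff_map_eq_zero]
  intro e he
  have hli := (P.linearIndependent hn hq ha hs).comp
    (fun i : Fin (KummerAlg.powerBasis hn.ne' s).dim =>
      ((⟨i, i.2.trans_eq (KummerAlg.powerBasis_dim (s := s) hn.ne')⟩, ⟨0, hn⟩) : Fin n × Fin n))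
    (fun i j hij => by simpa [Fin.ext_iff] using hij)
  rw [Fintype.linearIndependent_iff] at hli
  have e1 := (KummerAlg.powerBasis hn.ne' s).basis.sum_repr e
  rw [← e1]
  refine Finset.sum_eq_zero fun i _ => ?_
  rw [hli ((KummerAlg.powerBasis hn.ne' s).basis.repr e) ?_ i, zero_smul]
  rw [← he]
  conv_rhs => rw [← e1]
  rw [map_sum]
  refine Finset.sum_congr rfl fun i _ => ?_
  rw [map_smul, PowerBasis.basis_eq_pow, map_pow, KummerAlg.powerBasis_gen, P.ofKummer_root]
  simp

/-- A module over a cyclic algebra with a finite basis over `F[h] / (hⁿ - s)` yields a matrix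
whose norm is the scalar `a`. -/
theorem exists_matrixSigmaNorm_eq_of_module (P : IsCyclicPair q a s n x h) (hq : q ^ n = 1)
    {V : Type*} [AddCommGroup V] [Module D V] [Module (KummerAlg n s) V]
    (hV : ∀ (e : KummerAlg n s) (v : V), e • v = P.ofKummer e • v) {d : ℕ}
    (b : Module.Basis (Fin d) (KummerAlg n s) V) :
    ∃ Y : Matrix (Fin d) (Fin d) (KummerAlg n s),
      matrixSigmaNorm (KummerAlg.sigma s hq) Y n =
        algebraMap F (Matrix (Fin d) (Fin d) (KummerAlg n s)) a := by
  let φ : V →ₛₗ[(KummerAlg.sigma s hq : KummerAlg n s →+* KummerAlg n s)] V :=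
    { toFun := fun v => x • v
      map_add' := smul_add x
      map_smul' := fun e v => by
        rw [hV, hV, smul_smul, P.x_mul_ofKummer hq, mul_smul]; rfl }
  have hφ : ∀ k v, φ^[k] v = x ^ k • v := by
    intro k
    induction k with
    | zero => simp
    | succ k ih =>
      intro v
      rw [Function.iterate_succ_apply', ih, pow_succ', mul_smul]
      rfl
  refine (exists_matrixSigmaNorm_eq φ b (n := n) (a := algebraMap F _ a) fun v => ?_).imp
    fun Y hY => ?_
  · rw [hφ, P.x_pow, hV, AlgHom.commutes]
  · refine Eq.trans hY ?_
    ext i j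
    simp [Matrix.algebraMap_matrix_apply]

end IsCyclicPair

/-! ### The criterion for a cyclic algebra to be a division algebra. -/

namespace IsCyclicPair

variable {F D : Type*} [Field F] [Ring D] [Algebra F D] {q a s : F} {n : ℕ} {x h : D}

/-- The dimension over `F[h] / (hⁿ - s)` of a module over a cyclic algebra admits a matrix of
norm `a`. -/
theorem exists_matrixSigmaNorm_eq_of_finite (P : IsCyclicPair q a s n x h) (hn : 0 < n)
    (hq : q ^ n = 1) (hE : IsField (KummerAlg n s))
    (V : Type*) [AddCommGroup V] [Module D V] [Module F V] [IsScalarTower F D V]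
    [Module.Finite F V] :
    ∃ d : ℕ, n * d = Module.finrank F V ∧ ∃ Y : Matrix (Fin d) (Fin d) (KummerAlg n s),
      matrixSigmaNorm (KummerAlg.sigma s hq) Y n =
        algebraMap F (Matrix (Fin d) (Fin d) (KummerAlg n s)) a := by
  let _ : Module (KummerAlg n s) V := Module.compHom V (P.ofKummer : KummerAlg n s →+* D)
  have hV : ∀ (e : KummerAlg n s) (v : V), e • v = P.ofKummer e • v := fun _ _ => rfl
  have : IsScalarTower F (KummerAlg n s) V := ⟨fun c e v => by
    rw [hV, hV, map_smul, smul_assoc]⟩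
  have : Nontrivial (KummerAlg n s) := ⟨hE.exists_pair_ne⟩
  have : Module.Finite F (KummerAlg n s) := KummerAlg.finite hn.ne'
  have : Module.Finite (KummerAlg n s) V := Module.Finite.of_restrictScalars_finite F _ V
  have : Module.Free (KummerAlg n s) V := by
    let _ := hE.toField
    exact Module.Free.of_divisionRing (KummerAlg n s) V
  refine ⟨Module.finrank (KummerAlg n s) V, ?_,
    P.exists_matrixSigmaNorm_eq_of_module hq hV (Module.finBasis _ V)⟩
  rw [← Module.finrank_mul_finrank F (KummerAlg n s) V, KummerAlg.finrank hn.ne']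

theorem isField_of_noZeroDivisors (P : IsCyclicPair q a s n x h) (hn : 0 < n)
    (hq : IsPrimitiveRoot q n) (ha : a ≠ 0) (hs : s ≠ 0) [Nontrivial D] [NoZeroDivisors D] :
    IsField (KummerAlg n s) := by
  have : Module.Finite F (KummerAlg n s) := KummerAlg.finite hn.ne'
  have hinj := P.ofKummer_injective hn hq ha hs
  have : IsDomain D := NoZeroDivisors.to_isDomain D
  have : IsDomain (KummerAlg n s) := hinj.isDomain (P.ofKummer : KummerAlg n s →+* D)
  have : IsArtinianRing (KummerAlg n s) := IsArtinianRing.of_finite F _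
  exact IsArtinianRing.isField_of_isDomain _

theorem isUnit_of_ne_zero_of_finite [Nontrivial D] [NoZeroDivisors D] [Module.Finite F D]
    {d : D} (hd : d ≠ 0) : IsUnit d := by
  have : IsDomain D := NoZeroDivisors.to_isDomain D
  have : IsArtinianRing D := IsArtinianRing.of_finite F D
  exact IsArtinianRing.isUnit_of_mem_nonZeroDivisors (mem_nonZeroDivisors_of_ne_zero hd)

/-- In a cyclic division algebra, a matrix whose norm is `a` has size at least `n`. -/
theorem le_of_matrixSigmaNorm_eq (P : IsCyclicPair q a s n x h) (hn : 0 < n)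
    (hq : IsPrimitiveRoot q n) (ha : a ≠ 0) (hs : s ≠ 0) [Nontrivial D] [NoZeroDivisors D]
    (hgen : Algebra.adjoin F {x, h} = ⊤) {d : ℕ} (hd : 0 < d)
    {Y : Matrix (Fin d) (Fin d) (KummerAlg n s)}
    (hY : matrixSigmaNorm (KummerAlg.sigma s hq.pow_eq_one) Y n =
        algebraMap F (Matrix (Fin d) (Fin d) (KummerAlg n s)) a) : n ≤ d := by
  have hfin : Module.Finite F (KummerAlg n s) := KummerAlg.finite hn.ne'
  have hfinD : Module.Finite F D := P.finite hn hgen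
  have : Nontrivial (KummerAlg n s) := Module.nontrivial_of_finrank_pos (R := F)
    (by rw [KummerAlg.finrank hn.ne']; exact hn)
  set σ := KummerAlg.sigma s hq.pow_eq_one with hσ
  set ρ : KummerAlg n s := AdjoinRoot.root (X ^ n - C s) with hρ
  let V := Fin d → KummerAlg n s
  -- The matrix Y makes E^d a module over the cyclic algebra: x acts by φ, h by multiplication by
  -- the root. The norm condition says φⁿ = a.
  let φ : Module.End F V :=
    { toFun := fun v => Matrix.vecMul (σ ∘ v) Y
      map_add' := fun v w => by
        rw [← Matrix.add_vecMul]; congr 1; ext i; exact map_add σ _ _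
      map_smul' := fun c v => by
        rw [RingHom.id_apply, ← Matrix.smul_vecMul]; congr 1; ext i; exact map_smul σ _ _ }
  let H : Module.End F V := Algebra.lmul F (KummerAlg n s) ρ |>.compLeft (Fin d)
  have hH : ∀ v i, H v i = ρ * v i := fun v i => rfl
  have hφ : ∀ v, φ v = Matrix.vecMul (σ ∘ v) Y := fun v => rfl
  have hHk : ∀ k v i, (H ^ k) v i = ρ ^ k * v i := by
    intro k
    induction k with
    | zero => simp
    | succ k ih => intro v i; rw [pow_succ', Module.End.mul_apply, hH, ih, pow_succ', mul_assoc]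
  have P' : IsCyclicPair q a s n φ H := by
    refine ⟨?_, ?_, ?_⟩
    · refine LinearMap.ext fun v => ?_
      rw [Module.End.mul_apply, LinearMap.smul_apply, Module.End.mul_apply, hφ]
      have e : σ ∘ (H v) = (algebraMap F (KummerAlg n s) q * ρ) • (σ ∘ v) := by
        ext i
        rw [Function.comp_apply, hH, map_mul, hσ, hρ, KummerAlg.sigma_root]; rfl
      rw [e, Matrix.smul_vecMul, ← hφ]
      ext i
      rw [Pi.smul_apply, Pi.smul_apply, hH, smul_eq_mul, Algebra.smul_def, mul_assoc]
    · refine LinearMap.ext fun v => ?_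
      rw [Module.algebraMap_end_apply, Module.End.pow_apply]
      have e := iterate_semilinear_vecMul (σ : KummerAlg n s →+* KummerAlg n s) Y n v
      have e1 : (σ : KummerAlg n s →+* KummerAlg n s)^[n] ∘ v = v := by
        ext i
        exact KummerAlg.sigma_iterate hq.pow_eq_one _
      have e2 : matrixSigmaNorm (σ : KummerAlg n s →+* KummerAlg n s) Y n =
        algebraMap F (Matrix (Fin d) (Fin d) (KummerAlg n s)) a := hY
      rw [e1, e2, Algebra.algebraMap_eq_smul_one, Matrix.vecMul_smul, Matrix.vecMul_one] at e
      exact e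
    · refine LinearMap.ext fun v => ?_
      ext i
      rw [hHk, hρ, KummerAlg.root_pow, Module.algebraMap_end_apply, Pi.smul_apply,
        Algebra.smul_def]
  -- To let D itself act on E^d without a presentation of D, take the subalgebra A generated by the
  -- pairs (x, φ) and (h, H). It is again a cyclic algebra, hence simple, so its projection to D is
  -- injective and A has no zero divisors; it acts on E^d through the second factor.
  let B := D × Module.End F V
  let A : Subalgebra F B := Algebra.adjoin F {(x, φ), (h, H)}
  let x' : A := ⟨(x, φ), Algebra.subset_adjoin (by simp)⟩
  let h' : A := ⟨(h, H), Algebra.subset_adjoin (by simp)⟩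
  have PA : IsCyclicPair q a s n x' h' := by
    refine ⟨?_, ?_, ?_⟩
    · exact Subtype.ext (Prod.ext P.comm P'.comm)
    · exact Subtype.ext (Prod.ext P.x_pow P'.x_pow)
    · exact Subtype.ext (Prod.ext P.h_pow P'.h_pow)
  have hgenA : Algebra.adjoin F {x', h'} = ⊤ := by
    rw [← Algebra.adjoin_adjoin_coe_preimage (R := F) (s := {(x, φ), (h, H)})]
    congr 1
    ext ⟨z, hz⟩
    simp [x', h', Subtype.ext_iff]
  have : IsSimpleRing A := PA.isSimpleRing hn hq ha hs hgenA
  let π : A →ₐ[F] D := (AlgHom.fst F D _).comp A.val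
  have hπ : Function.Injective π := by
    have := @RingHom.injective A D _ _ _ _ π.toRingHom
    exact this
  have : NoZeroDivisors A := hπ.noZeroDivisors π (map_zero _) (map_mul _)
  have : Module.Finite F A := PA.finite hn hgenA
  have : Nonempty (Fin d) := ⟨⟨0, hd⟩⟩
  obtain ⟨v, hv⟩ := exists_ne (0 : V)
  -- Nonzero elements of A are units, so acting on one fixed v ≠ 0 is injective. Comparing
  -- dimensions over F gives n² ≤ dn.
  let ev : A →ₗ[F] V :=
    (LinearMap.applyₗ v).comp ((LinearMap.snd F D (Module.End F V)).comp A.val.toLinearMap)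
  have hev : Function.Injective ev := by
    rw [injective_iff_map_eq_zero]
    intro z hz
    by_contra hz0
    obtain ⟨w, hw⟩ := (isUnit_of_ne_zero_of_finite (F := F) hz0).exists_left_inv
    have e : z.1.2 v = 0 := hz
    have e1 : w.1.2 * z.1.2 = 1 := congrArg (fun z : A => z.1.2) hw
    apply hv
    have e2 := LinearMap.congr_fun e1 v
    rw [Module.End.mul_apply, e, map_zero] at e2
    exact e2.symm
  have h1 := LinearMap.finrank_le_finrank_of_injective hev
  rw [PA.finrank hn hq ha hs hgenA, Module.finrank_pi_fintype] at h1
  simp only [KummerAlg.finrank hn.ne', Finset.sum_const, Finset.card_univ, Fintype.card_fin,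
    smul_eq_mul] at h1
  exact Nat.le_of_mul_le_mul_right h1 hn

/-- If D has no zero divisors, D as a module over itself has dimension n over E and yields a matrix
of size n, while `le_of_matrixSigmaNorm_eq` excludes smaller ones. Conversely the simple Artinian
ring D is S^k for a simple module S. If S has dimension d over E, then n = kd and S yields a matrix
of size d, so minimality forces d = n and k = 1. Thus D is simple as a module over itself, that is,
a division ring. -/
theorem noZeroDivisors_iff (P : IsCyclicPair q a s n x h) (hn : 0 < n)
    (hq : IsPrimitiveRoot q n) (ha : a ≠ 0) (hs : s ≠ 0) [Nontrivial D]
    (hgen : Algebra.adjoin F {x, h} = ⊤) :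
    NoZeroDivisors D ↔ IsField (KummerAlg n s) ∧
      IsLeast {d : ℕ | 1 ≤ d ∧ d ∣ n ∧ ∃ Y : Matrix (Fin d) (Fin d) (KummerAlg n s),
        matrixSigmaNorm (KummerAlg.sigma s hq.pow_eq_one) Y n =
          algebraMap F (Matrix (Fin d) (Fin d) (KummerAlg n s)) a} n := by
  have hfinD : Module.Finite F D := P.finite hn hgen
  constructor
  · intro hD
    have hE := P.isField_of_noZeroDivisors hn hq ha hs
    refine ⟨hE, ⟨hn, dvd_rfl, ?_⟩, ?_⟩
    · obtain ⟨d, hd, hY⟩ := P.exists_matrixSigmaNorm_eq_of_finite hn hq.pow_eq_one hE D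
      rw [P.finrank hn hq ha hs hgen] at hd
      obtain rfl := Nat.eq_of_mul_eq_mul_left hn hd
      exact hY
    · rintro d ⟨hd, -, Y, hY⟩
      exact P.le_of_matrixSigmaNorm_eq hn hq ha hs hgen hd hY
  · rintro ⟨hE, -, hmin⟩
    have : IsSimpleRing D := P.isSimpleRing hn hq ha hs hgen
    have : IsArtinianRing D := IsArtinianRing.of_finite F D
    obtain ⟨k, hk0, S, hS, ⟨e⟩⟩ := (IsSimpleRing.isIsotypic D D).linearEquiv_fun
    have : Module.Finite F S := Module.Finite.of_injective (S.subtype.restrictScalars F)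
      S.injective_subtype
    obtain ⟨d, hd, Y, hY⟩ := P.exists_matrixSigmaNorm_eq_of_finite hn hq.pow_eq_one hE S
    have h1 := (e.restrictScalars F).finrank_eq
    rw [P.finrank hn hq ha hs hgen, Module.finrank_pi_fintype] at h1
    simp only [← hd, Finset.sum_const, Finset.card_univ, Fintype.card_fin, smul_eq_mul] at h1
    have h2 : n = k * d := Nat.eq_of_mul_eq_mul_left hn (by rw [h1]; ring)
    have hd0 : 1 ≤ d := Nat.pos_of_ne_zero (by rintro rfl; omega)
    have h3 : n ≤ d := hmin ⟨hd0, ⟨k, by rw [h2, mul_comm]⟩, Y, hY⟩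
    have hk : k = 1 := by
      have := hk0.out
      by_contra hk1
      have : 2 * d ≤ k * d := Nat.mul_le_mul_right d (by omega)
      omega
    subst hk
    have e' : D ≃ₗ[D] S := e.trans (LinearEquiv.funUnique (Fin 1) D S)
    have : IsSimpleModule D D := IsSimpleModule.congr e'
    have hu := isSimpleModule_self_iff_isUnit.1 this
    refine ⟨fun {b c} hbc => ?_⟩
    by_contra! hne
    have := (hu.2 b hne.1).mul_right_eq_zero.1 hbc
    exact hne.2 this

end IsCyclicPair

/-! ### The basis of normally ordered monomials; A₁ is a domain. -/

namespace QuantumWeyl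

variable {K : Type*} [Field K] (q : K)

/-- The space of polynomials in commuting variables on which `A₁` acts by left multiplication
of normally ordered monomials. -/
abbrev NormalSpace (K : Type*) [Field K] : Type _ := (ℕ × ℕ) →₀ K

/-- The action of `x` on normally ordered monomials. -/
noncomputable def actX : Module.End K (NormalSpace K) :=
  Finsupp.linearCombination K fun p : ℕ × ℕ =>
    q ^ p.1 • Finsupp.single (p.1, p.2 + 1) (1 : K) +
      (∑ i ∈ Finset.range p.1, q ^ i) • Finsupp.single (p.1 - 1, p.2) (1 : K)

/-- The action of `y` on normally ordered monomials. -/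
noncomputable def actY : Module.End K (NormalSpace K) :=
  Finsupp.linearCombination K fun p : ℕ × ℕ => Finsupp.single (p.1 + 1, p.2) (1 : K)

theorem actX_single (b a : ℕ) : actX q (Finsupp.single (b, a) 1) =
    q ^ b • Finsupp.single (b, a + 1) (1 : K) +
      (∑ i ∈ Finset.range b, q ^ i) • Finsupp.single (b - 1, a) (1 : K) := by
  rw [actX, Finsupp.linearCombination_single, one_smul]

theorem actY_single (b a : ℕ) :
    actY (Finsupp.single (b, a) (1 : K)) = Finsupp.single (b + 1, a) (1 : K) := by
  rw [actY, Finsupp.linearCombination_single, one_smul]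

theorem actX_mul_actY : actX q * actY - q • (actY * actX q) = 1 := by
  refine Finsupp.lhom_ext' fun p => LinearMap.ext_ring ?_
  obtain ⟨b, a⟩ := p
  simp only [LinearMap.comp_apply, Finsupp.lsingle_apply, LinearMap.sub_apply,
    LinearMap.smul_apply, Module.End.mul_apply, Module.End.one_apply, actY_single, actX_single,
    map_add, map_smul]
  rcases b with _ | b
  · simp
  · have e : ∑ i ∈ Finset.range (b + 1 + 1), q ^ i =
        q * ∑ i ∈ Finset.range (b + 1), q ^ i + 1 := by
      rw [Finset.sum_range_succ', Finset.mul_sum, pow_zero]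
      simp_rw [pow_succ']
    rw [e, smul_add, smul_smul, smul_smul, add_smul, one_smul, ← pow_succ', Nat.add_sub_cancel,
      Nat.add_sub_cancel]
    abel

/-- The representation of `A₁` on normally ordered monomials. -/
noncomputable def rep : QuantumWeyl q →ₐ[K] Module.End K (NormalSpace K) :=
  RingQuot.liftAlgHom K ⟨FreeAlgebra.lift K ![actX q, actY], by
    rintro _ _ ⟨⟩
    rw [map_sub, map_smul, map_mul, map_mul, map_one, FreeAlgebra.lift_ι_apply,
      FreeAlgebra.lift_ι_apply]
    exact actX_mul_actY q⟩

theorem rep_x : rep q (x q) = actX q := by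
  refine (RingQuot.liftAlgHom_mkAlgHom_apply K _ _ _).trans ?_
  rw [FreeAlgebra.lift_ι_apply]; rfl

theorem rep_y : rep q (y q) = actY := by
  refine (RingQuot.liftAlgHom_mkAlgHom_apply K _ _ _).trans ?_
  rw [FreeAlgebra.lift_ι_apply]; rfl

/-- The normally ordered monomials `yᵇ xᵃ`. -/
noncomputable def mon (p : ℕ × ℕ) : QuantumWeyl q := y q ^ p.1 * x q ^ p.2

/-- Applied to the vacuum vector, distinct monomials give distinct basis vectors, whence their
linear independence in A₁. -/
theorem rep_mon (p : ℕ × ℕ) : rep q (mon q p) (Finsupp.single (0, 0) 1) = Finsupp.single p 1 := by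
  obtain ⟨b, a⟩ := p
  rw [mon, map_mul, map_pow, map_pow, rep_x, rep_y, Module.End.mul_apply]
  have h1 : ∀ a, (actX q ^ a) (Finsupp.single (0, 0) (1 : K)) = Finsupp.single (0, a) 1 := by
    intro a
    induction a with
    | zero => simp
    | succ a ih => rw [pow_succ', Module.End.mul_apply, ih, actX_single]; simp
  have h2 : ∀ b a, (actY ^ b) (Finsupp.single (0, a) (1 : K)) = Finsupp.single (b, a) 1 := by
    intro b a
    induction b with
    | zero => simp
    | succ b ih => rw [pow_succ', Module.End.mul_apply, ih, actY_single]
  rw [h1, h2]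

theorem y_mul_mon (b a : ℕ) : y q * mon q (b, a) = mon q (b + 1, a) := by
  rw [mon, mon, ← mul_assoc, ← pow_succ']

theorem mon_mul_x (b a : ℕ) : mon q (b, a) * x q = mon q (b, a + 1) := by
  rw [mon, mon, mul_assoc, ← pow_succ]

theorem x_mul_mon (b a : ℕ) : x q * mon q (b, a) =
    q ^ b • mon q (b, a + 1) + (∑ i ∈ Finset.range b, q ^ i) • mon q (b - 1, a) := by
  rcases b with _ | b
  · simp [mon, pow_succ']
  · simp only [mon, Nat.add_sub_cancel]
    rw [← mul_assoc, x_mul_y_pow, add_mul, smul_mul_assoc, smul_mul_assoc, mul_assoc, ← pow_succ']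

theorem mon_mul_y (b a : ℕ) : mon q (b, a) * y q =
    q ^ a • mon q (b + 1, a) + (∑ i ∈ Finset.range a, q ^ i) • mon q (b, a - 1) := by
  rcases a with _ | a
  · simp [mon, pow_succ]
  · simp only [mon, Nat.add_sub_cancel]
    rw [mul_assoc, x_pow_mul_y, mul_add, mul_smul_comm, mul_smul_comm, ← mul_assoc, ← pow_succ]

variable {q} in
/-- A subspace that contains `1` and is stable under left multiplication by `x` and `y` is
everything. -/
theorem submodule_eq_top {S : Submodule K (QuantumWeyl q)} (h1 : 1 ∈ S)
    (hx : ∀ u ∈ S, x q * u ∈ S) (hy : ∀ u ∈ S, y q * u ∈ S) : S = ⊤ := by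
  have key : ∀ (w : FreeAlgebra K (Fin 2)), ∀ u ∈ S, mk q w * u ∈ S := by
    intro w
    induction w using FreeAlgebra.induction with
    | grade0 r =>
      intro u hu
      rw [AlgHom.commutes, ← Algebra.smul_def]; exact S.smul_mem r hu
    | grade1 i => fin_cases i <;> assumption
    | mul a b ha hb => intro u hu; rw [map_mul, mul_assoc]; exact ha _ (hb _ hu)
    | add a b ha hb => intro u hu; rw [map_add, add_mul]; exact S.add_mem (ha _ hu) (hb _ hu)
  rw [eq_top_iff]
  intro u _
  obtain ⟨w, rfl⟩ := RingQuot.mkAlgHom_surjective K (QuantumWeyl.Rel q) u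
  have := key w 1 h1
  rwa [mul_one] at this

theorem linearIndependent_mon : LinearIndependent K (mon q) := by
  refine LinearIndependent.of_comp
    ((LinearMap.applyₗ (Finsupp.single (0, 0) (1 : K))).comp (rep q).toLinearMap) ?_
  convert (Finsupp.basisSingleOne (R := K) (ι := ℕ × ℕ)).linearIndependent using 1
  ext1 p
  rw [Finsupp.coe_basisSingleOne]
  exact rep_mon q p

theorem span_mon : Submodule.span K (Set.range (mon q)) = ⊤ := by
  refine submodule_eq_top (Submodule.subset_span ⟨(0, 0), by simp [mon]⟩) ?_ ?_
  · intro u hu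
    induction hu using Submodule.span_induction with
    | mem u hu =>
      obtain ⟨⟨b, a⟩, rfl⟩ := hu
      rw [x_mul_mon]
      exact Submodule.add_mem _ (Submodule.smul_mem _ _ (Submodule.subset_span ⟨_, rfl⟩))
        (Submodule.smul_mem _ _ (Submodule.subset_span ⟨_, rfl⟩))
    | zero => rw [mul_zero]; exact Submodule.zero_mem _
    | add u v _ _ hu hv => rw [mul_add]; exact Submodule.add_mem _ hu hv
    | smul c u _ hu => rw [mul_smul_comm]; exact Submodule.smul_mem _ _ hu
  · intro u hu
    induction hu using Submodule.span_induction with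
    | mem u hu =>
      obtain ⟨⟨b, a⟩, rfl⟩ := hu
      rw [y_mul_mon]
      exact Submodule.subset_span ⟨_, rfl⟩
    | zero => rw [mul_zero]; exact Submodule.zero_mem _
    | add u v _ _ hu hv => rw [mul_add]; exact Submodule.add_mem _ hu hv
    | smul c u _ hu => rw [mul_smul_comm]; exact Submodule.smul_mem _ _ hu

/-- The basis of normally ordered monomials. -/
noncomputable def monBasis : Module.Basis (ℕ × ℕ) K (QuantumWeyl q) :=
  Module.Basis.mk (linearIndependent_mon q) (span_mon q).ge

theorem monBasis_apply (p : ℕ × ℕ) : monBasis q p = mon q p := Module.Basis.mk_apply _ _ p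

theorem repr_mon (p : ℕ × ℕ) : (monBasis q).repr (mon q p) = Finsupp.single p 1 := by
  rw [← monBasis_apply, Module.Basis.repr_self]

theorem nontrivial : Nontrivial (QuantumWeyl q) :=
  ⟨⟨mon q (0, 0), 0, by
    rw [← monBasis_apply]; exact (monBasis q).ne_zero _⟩⟩

/-- The subspace of elements of degree less than `m` in `x`. -/
noncomputable def low (m : ℕ) : Submodule K (QuantumWeyl q) :=
  Submodule.span K (mon q '' {p | p.2 < m})

variable {q}

theorem mon_mem_low {p : ℕ × ℕ} {m : ℕ} (h : p.2 < m) : mon q p ∈ low q m :=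
  Submodule.subset_span ⟨p, h, rfl⟩

theorem repr_eq_zero_of_mem_low {m : ℕ} {u : QuantumWeyl q} (hu : u ∈ low q m) {p : ℕ × ℕ}
    (hp : m ≤ p.2) : (monBasis q).repr u p = 0 := by
  unfold low at hu
  induction hu using Submodule.span_induction with
  | mem u hu =>
    obtain ⟨p', hp', rfl⟩ := hu
    rw [repr_mon, Finsupp.single_apply, if_neg]
    rintro rfl
    exact absurd hp' (not_lt.2 hp)
  | zero => simp
  | add u v _ _ hu hv => rw [map_add, Finsupp.add_apply, hu, hv, add_zero]
  | smul c u _ hu => rw [map_smul, Finsupp.smul_apply, hu, smul_zero]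

theorem map_mem_low (f : QuantumWeyl q →ₗ[K] QuantumWeyl q) {m m' : ℕ}
    (hf : ∀ p : ℕ × ℕ, p.2 < m → f (mon q p) ∈ low q m') {u : QuantumWeyl q} (hu : u ∈ low q m) :
    f u ∈ low q m' := by
  have : low q m ≤ (low q m').comap f := by
    unfold low
    rw [Submodule.span_le]
    rintro _ ⟨p, hp, rfl⟩
    exact hf p hp
  exact this hu

/-- Each interchange of x and y costs a factor q and leaves an error of lower degree in x. -/
theorem x_pow_mul_y_pow_sub_mem (a d : ℕ) :
    x q ^ a * y q ^ d - q ^ (a * d) • mon q (d, a) ∈ low q a := by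
  induction a with
  | zero => simp [mon]
  | succ a ih =>
    have h1 := map_mem_low (m' := a + 1) (LinearMap.mulLeft K (x q)) (fun p hp => by
      rw [LinearMap.mulLeft_apply, x_mul_mon]
      exact Submodule.add_mem _ (Submodule.smul_mem _ _ (mon_mem_low (by simpa using hp)))
        (Submodule.smul_mem _ _ (mon_mem_low (Nat.lt_succ_of_lt hp)))) ih
    rw [LinearMap.mulLeft_apply, mul_sub, ← mul_assoc, ← pow_succ', mul_smul_comm, x_mul_mon,
      smul_add, smul_smul, ← pow_add, ← sub_sub] at h1
    rw [Nat.succ_mul]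
    have h2 : q ^ (a * d) • (∑ i ∈ Finset.range d, q ^ i) • mon q (d - 1, a) ∈ low q (a + 1) :=
      Submodule.smul_mem _ _ (Submodule.smul_mem _ _ (mon_mem_low (Nat.lt_succ_self a)))
    simpa using Submodule.add_mem _ h1 h2

theorem mon_mul_mon_sub_mem (p p' : ℕ × ℕ) :
    mon q p * mon q p' - q ^ (p.2 * p'.1) • mon q (p + p') ∈ low q (p.2 + p'.2) := by
  obtain ⟨b, a⟩ := p
  obtain ⟨d, c⟩ := p'
  have h1 := map_mem_low (m' := a + c)
    ((LinearMap.mulLeft K (y q ^ b)).comp (LinearMap.mulRight K (x q ^ c))) (fun p hp => by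
      rw [LinearMap.comp_apply, LinearMap.mulLeft_apply, LinearMap.mulRight_apply, mon, mul_assoc,
        ← pow_add, ← mul_assoc, ← pow_add]
      exact mon_mem_low (p := (b + p.1, p.2 + c)) (by simpa using hp))
    (x_pow_mul_y_pow_sub_mem a d)
  simpa [mon, mul_assoc, sub_mul, mul_sub, pow_add] using h1

theorem repr_mon_mul_mon (p p' r : ℕ × ℕ) (hr : p.2 + p'.2 ≤ r.2) :
    (monBasis q).repr (mon q p * mon q p') r = if p + p' = r then q ^ (p.2 * p'.1) else 0 := by
  have h1 := repr_eq_zero_of_mem_low (mon_mul_mon_sub_mem (q := q) p p') hr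
  rw [map_sub, Finsupp.sub_apply, sub_eq_zero] at h1
  rw [h1, map_smul, repr_mon, Finsupp.smul_apply, Finsupp.single_apply]
  simp

/-- A nonzero element has a leading monomial. -/
theorem exists_leading {u : QuantumWeyl q} (hu : u ≠ 0) :
    ∃ p ∈ ((monBasis q).repr u).support, ∀ p' ∈ ((monBasis q).repr u).support,
      p'.2 < p.2 ∨ (p'.2 = p.2 ∧ p'.1 ≤ p.1) := by
  -- The x-exponent is compared first, because reordering errors are controlled by their degree in
  -- x.
  obtain ⟨p, hp, hmax⟩ := Finset.exists_max_image ((monBasis q).repr u).support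
    (fun p => toLex (p.2, p.1)) (by
      rw [Finsupp.support_nonempty_iff]
      simpa using hu)
  refine ⟨p, hp, fun p' hp' => ?_⟩
  have := hmax p' hp'
  rwa [Prod.Lex.toLex_le_toLex] at this

/-- In the product of two elements only the two leading monomials contribute at p + p', with
coefficient the product of the leading ones times a power of q. -/
theorem noZeroDivisors (hq0 : q ≠ 0) : NoZeroDivisors (QuantumWeyl q) := by
  refine ⟨fun {u v} huv => ?_⟩
  by_contra! hne
  obtain ⟨p, hp, hpmax⟩ := exists_leading hne.1
  obtain ⟨p', hp', hpmax'⟩ := exists_leading hne.2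
  set B := monBasis q
  have e : B.repr (u * v) (p + p') = B.repr u p * (B.repr v p' * q ^ (p.2 * p'.1)) := by
    conv_lhs => rw [← B.linearCombination_repr u, ← B.linearCombination_repr v]
    rw [Finsupp.linearCombination_apply, Finsupp.linearCombination_apply, Finsupp.sum,
      Finsupp.sum, Finset.sum_mul_sum, map_sum, Finsupp.finsetSum_apply]
    have e1 : ∀ r ∈ (B.repr u).support,
        (B.repr (∑ r' ∈ (B.repr v).support, (B.repr u r • B r) * (B.repr v r' • B r'))) (p + p') =
        if r = p then B.repr u p * (B.repr v p' * q ^ (p.2 * p'.1)) else 0 := by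
      intro r hr
      rw [map_sum, Finsupp.finsetSum_apply]
      have e2 : ∀ r' ∈ (B.repr v).support,
          (B.repr ((B.repr u r • B r) * (B.repr v r' • B r'))) (p + p') =
          if r' = p' then
            (if r = p then B.repr u p * (B.repr v p' * q ^ (p.2 * p'.1)) else 0) else 0 := by
        intro r' hr'
        have h1 := hpmax r hr
        have h2 := hpmax' r' hr'
        rw [smul_mul_smul_comm, map_smul, Finsupp.smul_apply, monBasis_apply, monBasis_apply,
          repr_mon_mul_mon _ _ _ (by simp only [Prod.snd_add]; omega)]
        by_cases hrr : r + r' = p + p'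
        · have h3 := congrArg Prod.fst hrr
          have h4 := congrArg Prod.snd hrr
          simp only [Prod.fst_add, Prod.snd_add] at h3 h4
          have h5 : r = p := Prod.ext (by omega) (by omega)
          have h6 : r' = p' := Prod.ext (by omega) (by omega)
          subst h5 h6
          rw [if_pos rfl, if_pos rfl, if_pos rfl, smul_eq_mul, mul_assoc]
        · rw [if_neg hrr, smul_zero]
          split_ifs with h5 h6
          · exact absurd (by rw [h5, h6]) hrr
          · rfl
          · rfl
      rw [Finset.sum_congr rfl e2, Finset.sum_ite_eq' _ p', if_pos hp']
    rw [Finset.sum_congr rfl e1, Finset.sum_ite_eq' _ p, if_pos hp]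
  rw [huv, map_zero, Finsupp.zero_apply] at e
  exact mul_ne_zero (Finsupp.mem_support_iff.1 hp)
    (mul_ne_zero (Finsupp.mem_support_iff.1 hp') (pow_ne_zero _ hq0)) e.symm

end QuantumWeyl

/-! ### The centre and coordinates over it. -/

namespace QuantumWeyl

variable {K : Type*} [Field K] {q : K}

theorem repr_x_mul (u : QuantumWeyl q) (b a : ℕ) :
    (monBasis q).repr (x q * u) (b, a + 1) = q ^ b * (monBasis q).repr u (b, a) +
      (∑ i ∈ Finset.range (b + 1), q ^ i) * (monBasis q).repr u (b + 1, a + 1) := by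
  have e : (Finsupp.lapply (b, a + 1)).comp
      ((monBasis q).repr.toLinearMap.comp (LinearMap.mulLeft K (x q))) =
      q ^ b • (Finsupp.lapply (b, a)).comp (monBasis q).repr.toLinearMap +
      (∑ i ∈ Finset.range (b + 1), q ^ i) •
        (Finsupp.lapply (b + 1, a + 1)).comp (monBasis q).repr.toLinearMap := by
    refine (monBasis q).ext fun ⟨d, c⟩ => ?_
    simp only [LinearMap.comp_apply, LinearMap.add_apply, LinearMap.smul_apply,
      Finsupp.lapply_apply, LinearEquiv.coe_coe, LinearMap.mulLeft_apply, monBasis_apply,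
      x_mul_mon, map_add, map_smul, repr_mon,
      Finsupp.single_apply, Prod.mk.injEq, add_left_inj, smul_eq_mul]
    congr 1
    · by_cases h : d = b ∧ c = a
      · rw [if_pos h, h.1]
      · rw [if_neg h, mul_zero, mul_zero]
    · rcases d with _ | d
      · simp
      · by_cases h : d = b ∧ c = a + 1
        · simp [h.1, h.2]
        · rw [if_neg (by simpa using h), if_neg (by simpa using h), mul_zero, mul_zero]
  exact LinearMap.congr_fun e u

theorem repr_mul_x (u : QuantumWeyl q) (b a : ℕ) :
    (monBasis q).repr (u * x q) (b, a + 1) = (monBasis q).repr u (b, a) := by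
  have e : (Finsupp.lapply (b, a + 1)).comp
      ((monBasis q).repr.toLinearMap.comp (LinearMap.mulRight K (x q))) =
      (Finsupp.lapply (b, a)).comp (monBasis q).repr.toLinearMap := by
    refine (monBasis q).ext fun ⟨d, c⟩ => ?_
    simp only [LinearMap.comp_apply,
      Finsupp.lapply_apply, LinearEquiv.coe_coe, LinearMap.mulRight_apply, monBasis_apply,
      mon_mul_x, repr_mon, Finsupp.single_apply, Prod.mk.injEq, add_left_inj]
  exact LinearMap.congr_fun e u

theorem repr_mul_y (u : QuantumWeyl q) (b a : ℕ) :
    (monBasis q).repr (u * y q) (b + 1, a) = q ^ a * (monBasis q).repr u (b, a) +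
      (∑ i ∈ Finset.range (a + 1), q ^ i) * (monBasis q).repr u (b + 1, a + 1) := by
  have e : (Finsupp.lapply (b + 1, a)).comp
      ((monBasis q).repr.toLinearMap.comp (LinearMap.mulRight K (y q))) =
      q ^ a • (Finsupp.lapply (b, a)).comp (monBasis q).repr.toLinearMap +
      (∑ i ∈ Finset.range (a + 1), q ^ i) •
        (Finsupp.lapply (b + 1, a + 1)).comp (monBasis q).repr.toLinearMap := by
    refine (monBasis q).ext fun ⟨d, c⟩ => ?_
    simp only [LinearMap.comp_apply, LinearMap.add_apply, LinearMap.smul_apply,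
      Finsupp.lapply_apply, LinearEquiv.coe_coe, LinearMap.mulRight_apply, monBasis_apply,
      mon_mul_y, map_add, map_smul, repr_mon,
      Finsupp.single_apply, Prod.mk.injEq, add_left_inj, smul_eq_mul]
    congr 1
    · by_cases h : d = b ∧ c = a
      · rw [if_pos h, h.2]
      · rw [if_neg h, mul_zero, mul_zero]
    · rcases c with _ | c
      · simp
      · by_cases h : d = b + 1 ∧ c = a
        · simp [h.1, h.2]
        · rw [if_neg (by simpa using h), if_neg (by simpa using h), mul_zero, mul_zero]
  exact LinearMap.congr_fun e u

theorem repr_y_mul (u : QuantumWeyl q) (b a : ℕ) :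
    (monBasis q).repr (y q * u) (b + 1, a) = (monBasis q).repr u (b, a) := by
  have e : (Finsupp.lapply (b + 1, a)).comp
      ((monBasis q).repr.toLinearMap.comp (LinearMap.mulLeft K (y q))) =
      (Finsupp.lapply (b, a)).comp (monBasis q).repr.toLinearMap := by
    refine (monBasis q).ext fun ⟨d, c⟩ => ?_
    simp only [LinearMap.comp_apply,
      Finsupp.lapply_apply, LinearEquiv.coe_coe, LinearMap.mulLeft_apply, monBasis_apply,
      y_mul_mon, repr_mon, Finsupp.single_apply, Prod.mk.injEq, add_left_inj]
  exact LinearMap.congr_fun e u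

/-- A finitely supported diagonal family with `f (k + 1) = c f k` and `c ≠ 0` vanishes. -/
theorem eq_zero_of_diagonal {f : ℕ × ℕ → K} {c : K} (hc : c ≠ 0) (hf : f.support.Finite)
    (hrec : ∀ b a, f (b + 1, a + 1) = c * f (b, a)) (p : ℕ × ℕ) : f p = 0 := by
  by_contra h
  have h1 : ∀ k : ℕ, f (p.1 + k, p.2 + k) ≠ 0 := by
    intro k
    induction k with
    | zero => exact h
    | succ k ih => rw [← add_assoc, ← add_assoc, hrec]; exact mul_ne_zero hc ih
  refine Set.infinite_of_injective_forall_mem (f := fun k : ℕ => (p.1 + k, p.2 + k)) ?_ h1 hf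
  intro k l hkl
  simpa using hkl

theorem dvd_of_geom_sum_eq_zero {n : ℕ} (hq : IsPrimitiveRoot q n) {b : ℕ}
    (h : ∑ i ∈ Finset.range b, q ^ i = 0) : n ∣ b := by
  have := geom_sum_mul q b
  rw [h, zero_mul] at this
  exact (hq.pow_eq_one_iff_dvd b).1 (sub_eq_zero.1 this.symm)

/-- The monomials that occur in a central element have exponents divisible by `n`. -/
theorem dvd_of_mem_center {n : ℕ} (hq1 : q ≠ 1) (hq : IsPrimitiveRoot q n) {z : QuantumWeyl q}
    (hz : z ∈ Subalgebra.center K (QuantumWeyl q)) {p : ℕ × ℕ}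
    (hp : (monBasis q).repr z p ≠ 0) : n ∣ p.1 ∧ n ∣ p.2 := by
  set c := (monBasis q).repr z
  have hc1 : (1 - q) ≠ 0 := sub_ne_zero.2 hq1.symm
  have hgs : ∀ b : ℕ, (1 - q) * ∑ i ∈ Finset.range b, q ^ i = 1 - q ^ b := fun b => by
    rw [mul_comm, geom_sum_mul_neg]
  have hfin : ∀ g : ℕ × ℕ → K, (fun p => g p * c p).support.Finite := fun g =>
    c.hasFiniteSupport.subset fun p hp => by
      rw [Function.mem_support] at hp ⊢
      exact right_ne_zero_of_mul hp
  constructor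
  -- With [b] = 1 + q + ⋯ + qᵇ⁻¹, commuting with x gives [b+1] c(b+1, a+1) = (1 - qᵇ) c(b, a) = (1 -
  -- q) [b] c(b, a). So [b] c(b, a) is geometric along diagonals, and finite support makes it
  -- vanish. Commuting with y does the same for a.
  · have h1 := eq_zero_of_diagonal (f := fun p => (∑ i ∈ Finset.range p.1, q ^ i) * c p) hc1
      (hfin fun p => ∑ i ∈ Finset.range p.1, q ^ i) (fun b a => by
        have e := repr_x_mul z b a
        rw [(Subalgebra.mem_center_iff.1 hz (x q)), repr_mul_x] at e
        change (∑ i ∈ Finset.range (b + 1), q ^ i) * c (b + 1, a + 1) = _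
        change c (b, a) = q ^ b * c (b, a) + _ * c (b + 1, a + 1) at e
        rw [← mul_assoc, hgs]
        linear_combination -e) p
    exact dvd_of_geom_sum_eq_zero hq ((mul_eq_zero.1 h1).resolve_right hp)
  · have h1 := eq_zero_of_diagonal (f := fun p => (∑ i ∈ Finset.range p.2, q ^ i) * c p) hc1
      (hfin fun p => ∑ i ∈ Finset.range p.2, q ^ i) (fun b a => by
        have e := repr_mul_y z b a
        rw [← (Subalgebra.mem_center_iff.1 hz (y q)), repr_y_mul] at e
        change (∑ i ∈ Finset.range (a + 1), q ^ i) * c (b + 1, a + 1) = _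
        change c (b, a) = q ^ a * c (b, a) + _ * c (b + 1, a + 1) at e
        rw [← mul_assoc, hgs]
        linear_combination -e) p
    exact dvd_of_geom_sum_eq_zero hq ((mul_eq_zero.1 h1).resolve_right hp)

section Coordinates

variable {n : ℕ} (hq1 : q ≠ 1) (hq : IsPrimitiveRoot q n)

theorem coe_r_pow_mul_t_pow (b a : ℕ) :
    (((r hq1 hq) ^ b * (t hq1 hq) ^ a : Z q) : QuantumWeyl q) = mon q (n * b, n * a) := by
  change (y q ^ n) ^ b * (x q ^ n) ^ a = _
  rw [mon, pow_mul, pow_mul]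

/-- The centre is spanned by the monomials in `r` and `t`. -/
theorem center_eq_span (z : Z q) :
    z ∈ Submodule.span K (Set.range fun p : ℕ × ℕ => (r hq1 hq) ^ p.1 * (t hq1 hq) ^ p.2) := by
  have e : z = ∑ p ∈ ((monBasis q).repr z.1).support, (monBasis q).repr z.1 p •
      ((r hq1 hq) ^ (p.1 / n) * (t hq1 hq) ^ (p.2 / n)) := by
    apply Subtype.ext
    conv_lhs => rw [← (monBasis q).linearCombination_repr z.1]
    rw [Finsupp.linearCombination_apply, Finsupp.sum, ← Subalgebra.coe_val, map_sum]
    refine Finset.sum_congr rfl fun p hp => ?_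
    obtain ⟨h1, h2⟩ := dvd_of_mem_center hq1 hq z.2 (Finsupp.mem_support_iff.1 hp)
    rw [map_smul, Subalgebra.coe_val, coe_r_pow_mul_t_pow, Nat.mul_div_cancel' h1,
      Nat.mul_div_cancel' h2, monBasis_apply]
  rw [e]
  exact Submodule.sum_mem _ fun p _ =>
    Submodule.smul_mem _ _ (Submodule.subset_span ⟨(p.1 / n, p.2 / n), rfl⟩)

/-- The coordinates of elements of `A₁` with respect to the monomials `yⁱ xʲ` with `i, j < n`,
over the centre. -/
noncomputable def coord (i j : ℕ) : QuantumWeyl q →ₗ[K] Z q :=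
  (monBasis q).constr K fun p : ℕ × ℕ =>
    if p.1 % n = i ∧ p.2 % n = j then (r hq1 hq) ^ (p.1 / n) * (t hq1 hq) ^ (p.2 / n) else 0

theorem coord_mon (i j : ℕ) (p : ℕ × ℕ) : coord hq1 hq i j (mon q p) =
    if p.1 % n = i ∧ p.2 % n = j then (r hq1 hq) ^ (p.1 / n) * (t hq1 hq) ^ (p.2 / n) else 0 := by
  rw [coord, ← monBasis_apply, Module.Basis.constr_basis]

theorem coord_one : coord hq1 hq 0 0 1 = 1 := by
  have : (1 : QuantumWeyl q) = mon q (0, 0) := by simp [mon]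
  rw [this, coord_mon]
  simp

theorem coord_r_mul (hn : 0 < n) (i j : ℕ) (u : QuantumWeyl q) :
    coord hq1 hq i j ((r hq1 hq).1 * u) = r hq1 hq * coord hq1 hq i j u := by
  have e : (coord hq1 hq i j).comp (LinearMap.mulLeft K (r hq1 hq).1) =
      (LinearMap.mulLeft K (r hq1 hq)).comp (coord hq1 hq i j) := by
    refine (monBasis q).ext fun ⟨b, a⟩ => ?_
    have e1 : (r hq1 hq).1 * mon q (b, a) = mon q (b + n, a) := by
      change y q ^ n * _ = _
      rw [mon, mon, ← mul_assoc, ← pow_add, add_comm]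
    rw [LinearMap.comp_apply, LinearMap.comp_apply, LinearMap.mulLeft_apply,
      LinearMap.mulLeft_apply, monBasis_apply, e1, coord_mon, coord_mon]
    simp only [Nat.add_mod_right, Nat.add_div_right _ hn, pow_succ']
    split_ifs
    · rw [mul_assoc]
    · rw [mul_zero]
  exact LinearMap.congr_fun e u

theorem coord_t_mul (hn : 0 < n) (i j : ℕ) (u : QuantumWeyl q) :
    coord hq1 hq i j ((t hq1 hq).1 * u) = t hq1 hq * coord hq1 hq i j u := by
  have e : (coord hq1 hq i j).comp (LinearMap.mulLeft K (t hq1 hq).1) =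
      (LinearMap.mulLeft K (t hq1 hq)).comp (coord hq1 hq i j) := by
    refine (monBasis q).ext fun ⟨b, a⟩ => ?_
    have e1 : (t hq1 hq).1 * mon q (b, a) = mon q (b, a + n) := by
      rw [← Subalgebra.mem_center_iff.1 (t hq1 hq).2]
      change _ * x q ^ n = _
      rw [mon, mon, mul_assoc, ← pow_add]
    rw [LinearMap.comp_apply, LinearMap.comp_apply, LinearMap.mulLeft_apply,
      LinearMap.mulLeft_apply, monBasis_apply, e1, coord_mon, coord_mon]
    simp only [Nat.add_mod_right, Nat.add_div_right _ hn, pow_succ']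
    split_ifs
    · ring
    · rw [mul_zero]
  exact LinearMap.congr_fun e u

/-- As r and t span the centre multiplicatively, linearity over Z(A₁) reduces to multiplication by
these two elements. -/
theorem coord_mul (hn : 0 < n) (i j : ℕ) (z : Z q) (u : QuantumWeyl q) :
    coord hq1 hq i j (z.1 * u) = z * coord hq1 hq i j u := by
  have hz := center_eq_span hq1 hq z
  induction hz using Submodule.span_induction with
  | mem z hz =>
    obtain ⟨⟨b, a⟩, rfl⟩ := hz
    have h1 : ∀ (a : ℕ) (u : QuantumWeyl q), coord hq1 hq i j (((t hq1 hq) ^ a : Z q).1 * u) =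
        (t hq1 hq) ^ a * coord hq1 hq i j u := by
      intro a
      induction a with
      | zero => intro u; rw [pow_zero, one_mul]; exact congrArg _ (one_mul u)
      | succ a ih =>
        intro u
        rw [pow_succ', mul_assoc, ← ih, ← coord_t_mul hq1 hq hn, ← mul_assoc]; rfl
    have h2 : ∀ (b : ℕ) (u : QuantumWeyl q), coord hq1 hq i j (((r hq1 hq) ^ b : Z q).1 * u) =
        (r hq1 hq) ^ b * coord hq1 hq i j u := by
      intro a
      induction a with
      | zero => intro u; rw [pow_zero, one_mul]; exact congrArg _ (one_mul u)
      | succ a ih =>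
        intro u
        rw [pow_succ', mul_assoc, ← ih, ← coord_r_mul hq1 hq hn, ← mul_assoc]; rfl
    rw [mul_assoc, ← h1, ← h2, ← mul_assoc]; rfl
  | zero => rw [zero_mul]; exact (congrArg _ (zero_mul u)).trans (map_zero _)
  | add z w _ _ hz hw =>
    rw [add_mul, ← hz, ← hw, ← map_add, ← add_mul]; rfl
  | smul c z _ hz =>
    rw [smul_mul_assoc, ← hz, ← map_smul, ← smul_mul_assoc]; rfl

theorem sum_coord (hn : 0 < n) (u : QuantumWeyl q) :
    ∑ i ∈ Finset.range n, ∑ j ∈ Finset.range n, (coord hq1 hq i j u).1 * mon q (i, j) = u := by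
  have e : ∑ i ∈ Finset.range n, ∑ j ∈ Finset.range n,
      (LinearMap.mulRight K (mon q (i, j))).comp
        ((Subalgebra.center K (QuantumWeyl q)).val.toLinearMap.comp (coord hq1 hq i j)) =
      LinearMap.id := by
    refine (monBasis q).ext fun ⟨b, a⟩ => ?_
    simp only [LinearMap.sum_apply, LinearMap.comp_apply, LinearMap.mulRight_apply,
      AlgHom.toLinearMap_apply, Subalgebra.coe_val, LinearMap.id_apply, monBasis_apply, coord_mon]
    rw [Finset.sum_eq_single (b % n), Finset.sum_eq_single (a % n)]
    · rw [if_pos ⟨rfl, rfl⟩, coe_r_pow_mul_t_pow]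
      have hx : ∀ k, x q ^ (n * k) * y q ^ (b % n) = y q ^ (b % n) * x q ^ (n * k) := fun k => by
        have h1 := Subalgebra.pow_mem _ (x_pow_mem_center hq1 hq) k
        rw [← pow_mul] at h1
        exact (Subalgebra.mem_center_iff.1 h1 _).symm
      simp only [mon]
      rw [mul_assoc, ← mul_assoc (x q ^ _), hx, mul_assoc, ← pow_add, ← mul_assoc, ← pow_add,
        Nat.div_add_mod, Nat.div_add_mod]
    · intro j _ hj
      rw [if_neg (fun h => hj h.2.symm)]
      exact zero_mul _
    · intro h
      exact absurd (Finset.mem_range.2 (Nat.mod_lt _ hn)) h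
    · intro i _ hi
      refine Finset.sum_eq_zero fun j _ => ?_
      rw [if_neg (fun h => hi h.1.symm)]
      exact zero_mul _
    · intro h
      exact absurd (Finset.mem_range.2 (Nat.mod_lt _ hn)) h
  have := LinearMap.congr_fun e u
  simpa [LinearMap.sum_apply] using this

end Coordinates

end QuantumWeyl

/-! ### Completely prime ideals and the fibres of A₁ over its centre. -/

theorem TwoSidedIdeal.isCompletelyPrime_iff {R : Type*} [Ring R] (P : TwoSidedIdeal R) :
    P.IsCompletelyPrime ↔ (1 : R) ∉ P ∧ ∀ a b, a * b ∈ P → a ∈ P ∨ b ∈ P := by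
  have hz : ∀ a : R, (P.ringCon.mk' a = 0) ↔ a ∈ P := fun a => by
    rw [← map_zero P.ringCon.mk', TwoSidedIdeal.mem_iff]
    exact RingCon.eq P.ringCon
  constructor
  · intro h
    have : IsDomain P.ringCon.Quotient := h
    refine ⟨fun h1 => ?_, fun a b hab => ?_⟩
    · rw [← hz, map_one] at h1
      exact one_ne_zero h1
    · rw [← hz, map_mul, mul_eq_zero, hz, hz] at hab
      exact hab
  · rintro ⟨h1, h2⟩
    have : Nontrivial P.ringCon.Quotient := ⟨1, 0, fun h => h1 ((hz 1).1 (by rw [map_one, h]))⟩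
    have : NoZeroDivisors P.ringCon.Quotient := ⟨fun {a b} hab => by
      obtain ⟨a, rfl⟩ := P.ringCon.mk'_surjective a
      obtain ⟨b, rfl⟩ := P.ringCon.mk'_surjective b
      rw [← map_mul, hz] at hab
      rw [hz, hz]
      exact h2 a b hab⟩
    exact NoZeroDivisors.to_isDomain P.ringCon.Quotient

namespace QuantumWeyl

open scoped TensorProduct

variable {K : Type*} [Field K] {q : K}

noncomputable instance : Algebra (Z q) (QuantumWeyl q) where
  smul z u := z.1 * u
  algebraMap := (Subalgebra.center K (QuantumWeyl q)).val.toRingHom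
  commutes' z u := (Subalgebra.mem_center_iff.1 z.2 u).symm
  smul_def' _ _ := rfl

theorem center_smul_def (z : Z q) (u : QuantumWeyl q) : z • u = z.1 * u := rfl

section Fibre

variable {n : ℕ} (hn : 0 < n) (hq1 : q ≠ 1) (hq : IsPrimitiveRoot q n)
  (F : Type*) [Field F] [Algebra (Z q) F]

/-- The image of an element of `A₁` in the fibre `F ⊗ A₁`. -/
noncomputable def fibreMap : QuantumWeyl q →ₐ[Z q] F ⊗[Z q] QuantumWeyl q :=
  Algebra.TensorProduct.includeRight

theorem fibreMap_center_mul (z : Z q) (u : QuantumWeyl q) :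
    fibreMap F (z.1 * u) = algebraMap (Z q) F z • fibreMap F u := by
  rw [← center_smul_def, map_smul, algebraMap_smul]

theorem fibreMap_center (z : Z q) :
    fibreMap F z.1 = algebraMap F (F ⊗[Z q] QuantumWeyl q) (algebraMap (Z q) F z) := by
  rw [← mul_one z.1, fibreMap_center_mul, map_one]
  exact (Algebra.algebraMap_eq_smul_one _).symm

variable {F} {p : Ideal (Z q)} (hp : ∀ z, algebraMap (Z q) F z = 0 ↔ z ∈ p)

include hn hp in
-- A coordinate followed by Z(A₁) → F is linear over the centre, so it extends to the fibre and
-- vanishes with the image of u.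
theorem coord_mem_of_fibreMap_eq_zero {u : QuantumWeyl q} (hu : fibreMap F u = 0) (i j : ℕ) :
    coord hq1 hq i j u ∈ p := by
  let φ : QuantumWeyl q →ₗ[Z q] F :=
    { toFun := fun u => algebraMap (Z q) F (coord hq1 hq i j u)
      map_add' := fun u v => by rw [map_add, map_add]
      map_smul' := fun z u => by
        rw [center_smul_def, coord_mul hq1 hq hn, map_mul, RingHom.id_apply, Algebra.smul_def] }
  let ψ : F ⊗[Z q] QuantumWeyl q →ₗ[Z q] F :=
    TensorProduct.lift ((LinearMap.mul (Z q) F).compl₂ φ)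
  have e : ψ (fibreMap F u) = algebraMap (Z q) F (coord hq1 hq i j u) := one_mul _
  rw [hu, map_zero] at e
  exact (hp _).1 e.symm

include hn hq1 hq hp in
theorem fibreMap_eq_zero_iff (u : QuantumWeyl q) : fibreMap F u = 0 ↔ u ∈ extLeft p := by
  constructor
  · intro hu
    rw [← sum_coord hq1 hq hn u]
    refine Ideal.sum_mem _ fun i _ => Ideal.sum_mem _ fun j _ => ?_
    rw [← Subalgebra.mem_center_iff.1 (coord hq1 hq i j u).2]
    exact Ideal.mul_mem_left _ _ (Ideal.mem_map_of_mem _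
      (coord_mem_of_fibreMap_eq_zero hn hq1 hq hp hu i j))
  · intro hu
    unfold extLeft Ideal.map at hu
    induction hu using Submodule.span_induction with
    | mem u hu =>
      obtain ⟨z, hz, rfl⟩ := hu
      have := fibreMap_center F z
      rw [(hp z).2 hz, map_zero] at this
      exact this
    | zero => exact map_zero _
    | add u v _ _ hu hv => rw [map_add, hu, hv, add_zero]
    | smul c u _ hu => rw [smul_eq_mul, map_mul, hu, mul_zero]

include hn hq1 hq hp in
theorem nontrivial_fibre : Nontrivial (F ⊗[Z q] QuantumWeyl q) := by
  refine ⟨1, 0, fun h1 => ?_⟩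
  rw [← map_one (fibreMap F)] at h1
  have := (hp _).2 (coord_mem_of_fibreMap_eq_zero hn hq1 hq hp h1 0 0)
  rw [coord_one, map_one] at this
  exact one_ne_zero this

variable (hfrac : ∀ f : F, ∃ z w : Z q, algebraMap (Z q) F w ≠ 0 ∧
  algebraMap (Z q) F w * f = algebraMap (Z q) F z)

include hfrac in
-- Clearing denominators: up to a nonzero central scalar, every element of the fibre comes from A₁.
theorem exists_smul_eq_fibreMap (d : F ⊗[Z q] QuantumWeyl q) :
    ∃ (w : Z q) (u : QuantumWeyl q), algebraMap (Z q) F w ≠ 0 ∧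
      algebraMap (Z q) F w • d = fibreMap F u := by
  induction d using TensorProduct.induction_on with
  | zero => exact ⟨1, 0, by simp, by simp⟩
  | tmul f u =>
    obtain ⟨z, w, hw, hf⟩ := hfrac f
    refine ⟨w, z.1 * u, hw, ?_⟩
    rw [TensorProduct.smul_tmul', smul_eq_mul, hf, fibreMap_center_mul]
    change _ = algebraMap (Z q) F z • ((1 : F) ⊗ₜ[Z q] u)
    rw [TensorProduct.smul_tmul', smul_eq_mul, mul_one]
  | add d e hd he =>
    obtain ⟨w, u, hw, hd⟩ := hd
    obtain ⟨w', u', hw', he⟩ := he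
    refine ⟨w * w', w'.1 * u + w.1 * u', by rw [map_mul]; exact mul_ne_zero hw hw', ?_⟩
    rw [map_mul, smul_add, map_add, fibreMap_center_mul, fibreMap_center_mul, ← hd, ← he,
      smul_smul, smul_smul, mul_comm (algebraMap (Z q) F w')]

include hn hq1 hq hp hfrac in
theorem ext_isCompletelyPrime_iff :
    (ext p).IsCompletelyPrime ↔ NoZeroDivisors (F ⊗[Z q] QuantumWeyl q) := by
  have hker := fibreMap_eq_zero_iff hn hq1 hq hp
  have := nontrivial_fibre hn hq1 hq hp
  have hmem : ∀ u, u ∈ ext p ↔ fibreMap F u = 0 := fun u => Ideal.mem_toTwoSided.trans (hker u).symm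
  rw [TwoSidedIdeal.isCompletelyPrime_iff]
  simp only [hmem]
  constructor
  · rintro ⟨-, h2⟩
    refine ⟨fun {d e} hde => ?_⟩
    obtain ⟨w, u, hw, hd⟩ := exists_smul_eq_fibreMap hfrac d
    obtain ⟨w', u', hw', he⟩ := exists_smul_eq_fibreMap hfrac e
    have h3 := h2 u u' (by rw [map_mul, ← hd, ← he, smul_mul_smul_comm, hde, smul_zero])
    rwa [← hd, ← he, smul_eq_zero_iff_right hw, smul_eq_zero_iff_right hw'] at h3
  · intro hD
    refine ⟨fun h1 => ?_, fun u v huv => ?_⟩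
    · rw [map_one] at h1
      exact one_ne_zero h1
    · rwa [map_mul, mul_eq_zero] at huv

include hn hq1 hq hp hfrac in
/-- If the fibre over `p = P ∩ Z(A₁)` is simple, then `P` is generated by its central elements. -/
theorem eq_ext_of_isCompletelyPrime {P : TwoSidedIdeal (QuantumWeyl q)}
    (hP : ∀ z : Z q, z ∈ p ↔ z.1 ∈ P)
    (hsimple : IsSimpleRing (F ⊗[Z q] QuantumWeyl q)) : P = ext p := by
  have hker := fibreMap_eq_zero_iff hn hq1 hq hp
  have hle : extLeft p ≤ P.asIdeal := by
    unfold extLeft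
    rw [Ideal.map_le_iff_le_comap]
    intro z hz
    exact (hP z).1 hz
  -- The extension of P to the fibre: the elements that land in the image of P once denominators are
  -- cleared.
  let I : TwoSidedIdeal (F ⊗[Z q] QuantumWeyl q) := TwoSidedIdeal.mk'
    {d | ∃ (w : Z q) (u : QuantumWeyl q), algebraMap (Z q) F w ≠ 0 ∧ u ∈ P ∧
      algebraMap (Z q) F w • d = fibreMap F u}
    ⟨1, 0, by simp, P.zero_mem, by simp⟩
    (by
      rintro d e ⟨w, u, hw, hu, hd⟩ ⟨w', u', hw', hu', he⟩
      refine ⟨w * w', w'.1 * u + w.1 * u', by rw [map_mul]; exact mul_ne_zero hw hw',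
        P.add_mem (P.mul_mem_left _ _ hu) (P.mul_mem_left _ _ hu'), ?_⟩
      rw [map_mul, smul_add, map_add, fibreMap_center_mul, fibreMap_center_mul, ← hd, ← he,
        smul_smul, smul_smul, mul_comm (algebraMap (Z q) F w')])
    (by
      rintro d ⟨w, u, hw, hu, hd⟩
      exact ⟨w, -u, hw, P.neg_mem hu, by rw [smul_neg, hd, map_neg]⟩)
    (by
      rintro e d ⟨w, u, hw, hu, hd⟩
      obtain ⟨w', u', hw', he⟩ := exists_smul_eq_fibreMap hfrac e
      refine ⟨w' * w, u' * u, by rw [map_mul]; exact mul_ne_zero hw' hw, P.mul_mem_left _ _ hu, ?_⟩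
      rw [map_mul, map_mul, ← hd, ← he, smul_mul_smul_comm])
    (by
      rintro d e ⟨w, u, hw, hu, hd⟩
      obtain ⟨w', u', hw', he⟩ := exists_smul_eq_fibreMap hfrac e
      refine ⟨w * w', u * u', by rw [map_mul]; exact mul_ne_zero hw hw', P.mul_mem_right _ _ hu, ?_⟩
      rw [map_mul, map_mul, ← hd, ← he, smul_mul_smul_comm])
  have hImem : ∀ d, d ∈ I ↔ ∃ (w : Z q) (u : QuantumWeyl q), algebraMap (Z q) F w ≠ 0 ∧ u ∈ P ∧
      algebraMap (Z q) F w • d = fibreMap F u := fun d => TwoSidedIdeal.mem_mk' ..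
  have hI : I = ⊥ := by
    -- If 1 were in I, some central w with nonzero image in F would lie in P, contradicting P ∩
    -- Z(A₁) = 𝔭.
    refine (hsimple.simple.eq_bot_or_eq_top I).resolve_right fun htop => ?_
    obtain ⟨w, u, hw, hu, h1⟩ := (hImem 1).1 ((TwoSidedIdeal.one_mem_iff I).2 htop)
    have h2 : fibreMap F (w.1 - u) = 0 := by
      rw [map_sub, ← h1, fibreMap_center, ← Algebra.algebraMap_eq_smul_one, sub_self]
    have h3 : w.1 - u ∈ P := hle ((hker _).1 h2)
    have h4 := P.add_mem h3 hu
    rw [sub_add_cancel] at h4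
    exact hw ((hp w).2 ((hP w).2 h4))
  ext u
  refine ⟨fun hu => ?_, fun hu => hle (Ideal.mem_toTwoSided.1 hu)⟩
  have h1 : fibreMap F u ∈ I := (hImem _).2 ⟨1, u, by simp, hu, by simp⟩
  rw [hI, TwoSidedIdeal.mem_bot] at h1
  exact Ideal.mem_toTwoSided.2 ((hker u).1 h1)

variable [Algebra K F] [IsScalarTower K (Z q) F]

theorem fibreMap_smul (c : K) (u : QuantumWeyl q) :
    fibreMap F (c • u) = algebraMap K F c • fibreMap F u := by
  have e : c • u = (algebraMap K (Z q) c).1 * u := Algebra.smul_def c u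
  rw [e, fibreMap_center_mul, ← IsScalarTower.algebraMap_apply]

theorem isCyclicPair_fibre : IsCyclicPair (algebraMap K F q) (algebraMap (Z q) F (t hq1 hq))
    (algebraMap (Z q) F (s hq1 hq)) n (fibreMap F (x q)) (fibreMap F (h q)) where
  comm := by rw [← map_mul, x_mul_h hq1, fibreMap_smul, map_mul]
  x_pow := by rw [← map_pow]; exact fibreMap_center F (t hq1 hq)
  h_pow := by rw [← map_pow]; exact fibreMap_center F (s hq1 hq)

include hn in
-- Since t becomes invertible, y = t⁻¹(yx)xⁿ⁻¹, and yx differs from h by a scalar.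
theorem adjoin_fibre (ht : algebraMap (Z q) F (t hq1 hq) ≠ 0) :
    Algebra.adjoin F {fibreMap F (x q), fibreMap F (h q)} = ⊤ := by
  set S := Algebra.adjoin F {fibreMap F (x q), fibreMap F (h q)} with hS
  have hx : fibreMap F (x q) ∈ S := Algebra.subset_adjoin (by simp)
  have hh : fibreMap F (h q) ∈ S := Algebra.subset_adjoin (by simp)
  have hyx : fibreMap F (y q * x q) ∈ S := by
    have e : y q * x q = h q - (1 / (q - 1)) • 1 := by
      rw [h, ← Algebra.algebraMap_eq_smul_one, add_sub_cancel_right]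
    rw [e, map_sub, fibreMap_smul, map_one]
    exact S.sub_mem hh (S.smul_mem S.one_mem _)
  have hy : fibreMap F (y q) ∈ S := by
    have e : fibreMap F (y q) = (algebraMap (Z q) F (t hq1 hq))⁻¹ •
        (fibreMap F (y q * x q) * fibreMap F (x q) ^ (n - 1)) := by
      rw [map_mul, mul_assoc, ← pow_succ', Nat.sub_add_cancel hn,
        (isCyclicPair_fibre hq1 hq (F := F)).x_pow, ← Algebra.commutes, ← Algebra.smul_def,
        smul_smul, inv_mul_cancel₀ ht, one_smul]
    rw [e]
    exact S.smul_mem (S.mul_mem hyx (S.pow_mem hx _)) _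
  have hall : ∀ u, fibreMap F u ∈ S := by
    intro u
    let T : Submodule K (QuantumWeyl q) :=
      { carrier := {u | fibreMap F u ∈ S}
        add_mem' := fun {u v} hu hv => by
          rw [Set.mem_ofPred_eq, map_add]; exact S.add_mem hu hv
        zero_mem' := by rw [Set.mem_ofPred_eq, map_zero]; exact S.zero_mem
        smul_mem' := fun c u hu => by
          rw [Set.mem_ofPred_eq, fibreMap_smul]; exact S.smul_mem hu _ }
    have hT : T = ⊤ := submodule_eq_top (by
        change fibreMap F 1 ∈ S
        rw [map_one]; exact S.one_mem)
      (fun u hu => by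
        change fibreMap F _ ∈ S
        rw [map_mul]; exact S.mul_mem hx hu)
      (fun u hu => by
        change fibreMap F _ ∈ S
        rw [map_mul]; exact S.mul_mem hy hu)
    have : u ∈ T := hT ▸ Submodule.mem_top
    exact this
  rw [eq_top_iff]
  intro d _
  induction d using TensorProduct.induction_on with
  | zero => exact S.zero_mem
  | tmul f u =>
    have e : f ⊗ₜ[Z q] u = f • fibreMap F u := by
      change _ = f • ((1 : F) ⊗ₜ[Z q] u)
      rw [TensorProduct.smul_tmul', smul_eq_mul, mul_one]
    rw [e]
    exact S.smul_mem (hall u) _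
  | add d e hd he => exact S.add_mem (hd trivial) (he trivial)

end Fibre

end QuantumWeyl

/-! ### Fractions in a residue field. -/

section ResidueField

variable {R : Type*} [CommRing R] {p : Ideal R}

theorem algebraMap_fractionRing_quotient_eq_zero_iff (z : R) :
    algebraMap R (FractionRing (R ⧸ p)) z = 0 ↔ z ∈ p := by
  rw [IsScalarTower.algebraMap_apply R (R ⧸ p), FaithfulSMul.algebraMap_eq_zero_iff,
    Ideal.Quotient.algebraMap_eq, Ideal.Quotient.eq_zero_iff_mem]

theorem exists_fraction_fractionRing_quotient [p.IsPrime] (f : FractionRing (R ⧸ p)) :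
    ∃ z w : R, algebraMap R (FractionRing (R ⧸ p)) w ≠ 0 ∧
      algebraMap R (FractionRing (R ⧸ p)) w * f = algebraMap R (FractionRing (R ⧸ p)) z := by
  obtain ⟨z, w, hw, hf⟩ := IsFractionRing.div_surjective (A := R ⧸ p) f
  obtain ⟨z, rfl⟩ := Ideal.Quotient.mk_surjective z
  obtain ⟨w, rfl⟩ := Ideal.Quotient.mk_surjective w
  have hw0 : algebraMap (R ⧸ p) (FractionRing (R ⧸ p)) (Ideal.Quotient.mk p w) ≠ 0 := by
    rw [Ne, FaithfulSMul.algebraMap_eq_zero_iff]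
    exact nonZeroDivisors.ne_zero hw
  refine ⟨z, w, hw0, ?_⟩
  rw [← hf]
  exact mul_div_cancel₀ _ hw0

end ResidueField

/-! ### The completely prime ideals containing h. -/

namespace QuantumWeyl

variable {K : Type*} [Field K] {q : K}

theorem x_mul_y_eq_h (hq1 : q ≠ 1) :
    x q * y q = q • h q - (1 / (q - 1)) • (1 : QuantumWeyl q) := by
  have hne : q - 1 ≠ 0 := sub_ne_zero.2 hq1
  rw [x_mul_y', h, smul_add, Algebra.algebraMap_eq_smul_one, smul_smul, add_sub_assoc, ← sub_smul]
  congr 1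
  have e : q * (1 / (q - 1)) - 1 / (q - 1) = 1 := by field_simp
  rw [e, one_smul]

theorem y_mul_x_eq_h : y q * x q = h q - (1 / (q - 1)) • (1 : QuantumWeyl q) := by
  rw [h, ← Algebra.algebraMap_eq_smul_one, add_sub_cancel_right]

/-- Modulo `h`, every element becomes a polynomial in `x` after multiplication by a power
of `x`. -/
theorem exists_mul_x_pow_sub_mem {J : TwoSidedIdeal (QuantumWeyl q)} (hJ : h q ∈ J)
    (u : QuantumWeyl q) : ∃ (N : ℕ) (f : K[X]), u * x q ^ N - aeval (x q) f ∈ J := by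
  let S : Submodule K (QuantumWeyl q) :=
    { carrier := {u | ∃ (N : ℕ) (f : K[X]), u * x q ^ N - aeval (x q) f ∈ J}
      zero_mem' := ⟨0, 0, by simp⟩
      add_mem' := by
        rintro u v ⟨N, f, hf⟩ ⟨M, g, hg⟩
        refine ⟨N + M, f * X ^ M + g * X ^ N, ?_⟩
        convert J.add_mem (J.mul_mem_right _ (x q ^ M) hf) (J.mul_mem_right _ (x q ^ N) hg)
          using 1
        rw [map_add, map_mul, map_mul, map_pow, map_pow, aeval_X, sub_mul, sub_mul, add_mul,
          mul_assoc u, mul_assoc v, ← pow_add, ← pow_add, add_comm M N]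
        abel
      smul_mem' := by
        rintro c u ⟨N, f, hf⟩
        refine ⟨N, c • f, ?_⟩
        rw [map_smul, smul_mul_assoc, ← smul_sub]
        exact J.smul_mem_of_mem c hf }
  have hS : S = ⊤ := by
    refine submodule_eq_top ⟨0, 1, by simp⟩ ?_ ?_
    · rintro u ⟨N, f, hf⟩
      refine ⟨N, X * f, ?_⟩
      rw [map_mul, aeval_X, mul_assoc, ← mul_sub]
      exact J.mul_mem_left _ _ hf
    · rintro u ⟨N, f, hf⟩
      -- Modulo J, y u xᴺ⁺¹ ≡ y f(x) x = (yx) f(x), and yx ≡ -1/(q-1).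
      refine ⟨N + 1, -((1 / (q - 1)) • f), ?_⟩
      have e1 : aeval (x q) f * x q = x q * aeval (x q) f := by
        have := congrArg (aeval (x q)) (mul_comm f X)
        rwa [map_mul, map_mul, aeval_X] at this
      have e : y q * u * x q ^ (N + 1) - aeval (x q) (-((1 / (q - 1)) • f)) =
          y q * (u * x q ^ N - aeval (x q) f) * x q + h q * aeval (x q) f := by
        rw [mul_sub, sub_mul, mul_assoc (y q) (aeval _ _), e1, ← mul_assoc (y q) (x q),
          y_mul_x_eq_h, sub_mul, smul_mul_assoc, one_mul, map_neg, map_smul, pow_succ]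
        simp only [mul_assoc]
        abel
      rw [e]
      exact J.add_mem (J.mul_mem_right _ _ (J.mul_mem_left _ _ hf)) (J.mul_mem_right _ _ hJ)
  have : u ∈ S := hS ▸ Submodule.mem_top
  exact this

/-- Modulo h the product xy is a nonzero scalar, so powers of x can be cancelled on the right. -/
theorem mem_of_mul_x_pow_mem (hq1 : q ≠ 1) {J : TwoSidedIdeal (QuantumWeyl q)} (hJ : h q ∈ J)
    {u : QuantumWeyl q} {N : ℕ} (hu : u * x q ^ N ∈ J) : u ∈ J := by
  have hne : (1 / (q - 1) : K) ≠ 0 := one_div_ne_zero (sub_ne_zero.2 hq1)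
  induction N with
  | zero => simpa using hu
  | succ N ih =>
    refine ih (J.mem_of_smul_mem hne ?_)
    have e : (1 / (q - 1)) • (u * x q ^ N) =
        q • (u * x q ^ N * h q) - u * x q ^ (N + 1) * y q := by
      rw [pow_succ, mul_assoc u (_ * _), mul_assoc (x q ^ N), x_mul_y_eq_h hq1, mul_sub, mul_sub,
        mul_smul_comm, mul_smul_comm, mul_smul_comm, mul_smul_comm, mul_one, mul_assoc]
      abel
    rw [e]
    exact J.sub_mem (J.smul_mem_of_mem _ (J.mul_mem_left _ _ hJ)) (J.mul_mem_right _ _ hu)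

/-- Ideals that contain `h` are determined by the polynomials in `x` that they contain. -/
theorem le_of_h_mem (hq1 : q ≠ 1) {P J : TwoSidedIdeal (QuantumWeyl q)} (hP : h q ∈ P)
    (hJ : h q ∈ J) (H : ∀ f : K[X], aeval (x q) f ∈ P → aeval (x q) f ∈ J) : P ≤ J := by
  intro u hu
  -- Working modulo P ⊓ J gives one polynomial that serves both ideals.
  obtain ⟨N, f, hf⟩ := exists_mul_x_pow_sub_mem (J := P ⊓ J)
    ((TwoSidedIdeal.mem_inf _).2 ⟨hP, hJ⟩) u
  rw [TwoSidedIdeal.mem_inf] at hf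
  have h1 : aeval (x q) f ∈ P := by
    have := P.sub_mem (P.mul_mem_right _ (x q ^ N) hu) hf.1
    rwa [sub_sub_cancel] at this
  have h2 := J.add_mem hf.2 (H f h1)
  rw [sub_add_cancel] at h2
  exact mem_of_mul_x_pow_mem hq1 hJ h2

theorem x_notMem {P : TwoSidedIdeal (QuantumWeyl q)} (hP : (1 : QuantumWeyl q) ∉ P) : x q ∉ P := by
  intro hx
  apply hP
  rw [← x_mul_y q]
  exact P.sub_mem (P.mul_mem_right _ _ hx) (P.smul_mem_of_mem _ (P.mul_mem_left _ _ hx))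

theorem y_notMem {P : TwoSidedIdeal (QuantumWeyl q)} (hP : (1 : QuantumWeyl q) ∉ P) : y q ∉ P := by
  intro hy
  apply hP
  rw [← x_mul_y q]
  exact P.sub_mem (P.mul_mem_left _ _ hy) (P.smul_mem_of_mem _ (P.mul_mem_right _ _ hy))

theorem span_insert_h_le {P : TwoSidedIdeal (QuantumWeyl q)} (hP : h q ∈ P) {f : K[X]}
    (hf : aeval (x q) f ∈ P) : TwoSidedIdeal.span {h q, aeval (x q) f} ≤ P := by
  rw [TwoSidedIdeal.span_le]
  rintro _ (rfl | rfl)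
  exacts [hP, hf]

/-- This makes (h) the case f = 0 of (h, f(x)), so both families are treated together. -/
theorem span_pair_zero : TwoSidedIdeal.span {h q, aeval (x q) (0 : K[X])} =
    TwoSidedIdeal.span {h q} := by
  refine le_antisymm ?_ (TwoSidedIdeal.span_mono (Set.singleton_subset_iff.2 (Or.inl rfl)))
  refine span_insert_h_le (q := q) (f := 0) (TwoSidedIdeal.subset_span (Set.mem_singleton _)) ?_
  rw [map_zero]
  exact TwoSidedIdeal.zero_mem _

theorem le_span_insert_h (hq1 : q ≠ 1) {P : TwoSidedIdeal (QuantumWeyl q)} (hP : h q ∈ P)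
    {f : K[X]} (H : ∀ g : K[X], aeval (x q) g ∈ P → f ∣ g) :
    P ≤ TwoSidedIdeal.span {h q, aeval (x q) f} := by
  refine le_of_h_mem hq1 hP (TwoSidedIdeal.subset_span (by simp)) fun g hg => ?_
  obtain ⟨g, rfl⟩ := H g hg
  rw [map_mul]
  exact TwoSidedIdeal.mul_mem_right _ _ _ (TwoSidedIdeal.subset_span (by simp))

section ToField

variable {L : Type*} [Field L] [Algebra K L]

/-- The homomorphism `A₁ → L` with `x ↦ u` and `h ↦ 0`. -/
noncomputable def toField (hq1 : q ≠ 1) {u : L} (hu : u ≠ 0) : QuantumWeyl q →ₐ[K] L :=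
  RingQuot.liftAlgHom K
    ⟨FreeAlgebra.lift K ![u, -(algebraMap K L (1 / (q - 1)) * u⁻¹)], by
      rintro _ _ ⟨⟩
      rw [map_sub, map_smul, map_mul, map_mul, map_one, FreeAlgebra.lift_ι_apply,
        FreeAlgebra.lift_ι_apply]
      change u * -(algebraMap K L (1 / (q - 1)) * u⁻¹) -
        q • (-(algebraMap K L (1 / (q - 1)) * u⁻¹) * u) = 1
      have e : algebraMap K L q * algebraMap K L (1 / (q - 1)) - algebraMap K L (1 / (q - 1)) =
          1 := by
        rw [← map_mul, ← map_sub, ← map_one (algebraMap K L)]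
        congr 1
        have hne : q - 1 ≠ 0 := sub_ne_zero.2 hq1
        field_simp
      rw [Algebra.smul_def]
      have hu1 : u⁻¹ * u = 1 := inv_mul_cancel₀ hu
      linear_combination e + (algebraMap K L q * algebraMap K L (1 / (q - 1)) -
        algebraMap K L (1 / (q - 1))) * hu1⟩

theorem toField_x (hq1 : q ≠ 1) {u : L} (hu : u ≠ 0) : toField hq1 hu (x q) = u := by
  refine (RingQuot.liftAlgHom_mkAlgHom_apply K _ _ _).trans ?_
  rw [FreeAlgebra.lift_ι_apply]; rfl

theorem toField_y (hq1 : q ≠ 1) {u : L} (hu : u ≠ 0) :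
    toField hq1 hu (y q) = -(algebraMap K L (1 / (q - 1)) * u⁻¹) := by
  refine (RingQuot.liftAlgHom_mkAlgHom_apply K _ _ _).trans ?_
  rw [FreeAlgebra.lift_ι_apply]; rfl

theorem toField_h (hq1 : q ≠ 1) {u : L} (hu : u ≠ 0) : toField hq1 hu (h q) = 0 := by
  rw [h, map_add, map_mul, toField_x, toField_y, AlgHom.commutes, neg_mul, mul_assoc,
    inv_mul_cancel₀ hu, mul_one, neg_add_cancel]

/-- The ideal is the kernel of the map from A₁ to the field L sending x to u and h to 0. -/
theorem isCompletelyPrime_span_insert_h (hq1 : q ≠ 1) {u : L} (hu : u ≠ 0) {f : K[X]}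
    (hf : ∀ g : K[X], aeval u g = 0 ↔ f ∣ g) :
    (TwoSidedIdeal.span {h q, aeval (x q) f}).IsCompletelyPrime := by
  have ha : ∀ g : K[X], toField hq1 hu (aeval (x q) g) = aeval u g := fun g => by
    rw [← aeval_algHom_apply, toField_x]
  have e : TwoSidedIdeal.span {h q, aeval (x q) f} = TwoSidedIdeal.ker (toField hq1 hu) := by
    refine le_antisymm (span_insert_h_le ?_ ?_) (le_span_insert_h hq1 ?_ fun g hg => ?_)
    · rw [TwoSidedIdeal.mem_ker, toField_h]
    · rw [TwoSidedIdeal.mem_ker, ha, hf]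
    · rw [TwoSidedIdeal.mem_ker, toField_h]
    · rwa [TwoSidedIdeal.mem_ker, ha, hf] at hg
  rw [e, TwoSidedIdeal.isCompletelyPrime_iff]
  simp only [TwoSidedIdeal.mem_ker]
  refine ⟨by rw [map_one]; exact one_ne_zero, fun a b hab => ?_⟩
  rwa [map_mul, mul_eq_zero] at hab

end ToField

theorem isCompletelyPrime_span_h (hq1 : q ≠ 1) :
    (TwoSidedIdeal.span {h q}).IsCompletelyPrime := by
  rw [← span_pair_zero]
  refine isCompletelyPrime_span_insert_h hq1 (L := FractionRing K[X])
    (u := algebraMap K[X] (FractionRing K[X]) X) ?_ fun g => ?_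
  · rw [Ne, FaithfulSMul.algebraMap_eq_zero_iff]
    exact X_ne_zero
  · rw [aeval_algebraMap_apply, aeval_X_left_apply, FaithfulSMul.algebraMap_eq_zero_iff,
      zero_dvd_iff]

/-- Here L = K[X]/(f) and u is the root of f, which is nonzero because f does not divide X. -/
theorem isCompletelyPrime_span_h_irreducible (hq1 : q ≠ 1) {f : K[X]} (hm : f.Monic)
    (hf : Irreducible f) (hX : f ≠ X) :
    (TwoSidedIdeal.span {h q, aeval (x q) f}).IsCompletelyPrime := by
  have : Fact (Irreducible f) := ⟨hf⟩
  have hdvd : ∀ g : K[X], aeval (AdjoinRoot.root f) g = 0 ↔ f ∣ g := fun g => by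
    rw [AdjoinRoot.aeval_eq, AdjoinRoot.mk_eq_zero]
  refine isCompletelyPrime_span_insert_h hq1 (L := AdjoinRoot f) (u := AdjoinRoot.root f)
    (fun h0 => hX ?_) hdvd
  have h1 : f ∣ X := by rw [← hdvd, aeval_X, h0]
  exact eq_of_monic_of_associated hm monic_X (hf.associated_of_dvd irreducible_X h1)

/-- The completely prime ideals that contain `h`. -/
theorem eq_span_of_h_mem (hq1 : q ≠ 1) {P : TwoSidedIdeal (QuantumWeyl q)}
    (hP : P.IsCompletelyPrime) (hh : h q ∈ P) :
    P = TwoSidedIdeal.span {h q} ∨ ∃ f : K[X], f.Monic ∧ Irreducible f ∧ f ≠ X ∧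
      P = TwoSidedIdeal.span {h q, aeval (x q) f} := by
  rw [TwoSidedIdeal.isCompletelyPrime_iff] at hP
  -- The polynomials in x inside P form a prime ideal of a principal ideal domain, and with h they
  -- determine P. If it is nonzero, its normalized generator is f; f = X would put x in P.
  let I : Ideal K[X] := P.asIdeal.comap (aeval (x q) : K[X] →ₐ[K] QuantumWeyl q)
  have hI : ∀ f, f ∈ I ↔ aeval (x q) f ∈ P := fun f => Iff.rfl
  have hprime : I.IsPrime := by
    refine ⟨?_, fun {f g} hfg => ?_⟩
    · rw [Ne, Ideal.eq_top_iff_one, hI, map_one]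
      exact hP.1
    · rw [hI, map_mul] at hfg
      exact hP.2 _ _ hfg
  by_cases h0 : I = ⊥
  · left
    rw [← span_pair_zero]
    refine le_antisymm (le_span_insert_h hq1 hh fun g hg => ?_)
      (span_insert_h_le hh (by rw [map_zero]; exact P.zero_mem))
    rw [← hI, h0, Ideal.mem_bot] at hg
    rw [hg]
  · right
    classical
    have hg := Submodule.IsPrincipal.prime_generator_of_isPrime I h0
    set g := Submodule.IsPrincipal.generator I with hgdef
    have hass : Associated (normalize g) g := normalize_associated g
    have hmem : ∀ f, f ∈ I ↔ normalize g ∣ f := fun f => by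
      rw [hass.dvd_iff_dvd_left]
      exact Submodule.IsPrincipal.mem_iff_generator_dvd I
    refine ⟨normalize g, monic_normalize hg.ne_zero, hass.symm.irreducible hg.irreducible, ?_, ?_⟩
    · intro hX
      have : X ∈ I := by rw [hmem, hX]
      rw [hI, aeval_X] at this
      exact x_notMem hP.1 this
    · refine le_antisymm (le_span_insert_h hq1 hh fun f hf => ?_) (span_insert_h_le hh ?_)
      · rwa [← hmem, hI]
      · rw [← hI, hmem]

/-! ### The completely prime ideals not containing h, and the classification. -/

section FractionField

variable {p : Ideal (Z q)}

theorem algebraMap_k_eq_zero_iff (z : Z q) : algebraMap (Z q) (k p) z = 0 ↔ z ∈ p :=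
  algebraMap_fractionRing_quotient_eq_zero_iff z

theorem exists_fraction_k [p.IsPrime] (f : k p) : ∃ z w : Z q, algebraMap (Z q) (k p) w ≠ 0 ∧
    algebraMap (Z q) (k p) w * f = algebraMap (Z q) (k p) z :=
  exists_fraction_fractionRing_quotient f

noncomputable instance : SMul (Z q) (k p) := Algebra.toSMul

theorem isScalarTower_k (p : Ideal (Z q)) : IsScalarTower K (Z q) (k p) :=
  IsScalarTower.of_algebraMap_eq fun _ => rfl

theorem ext_isCompletelyPrime_iff_isLeast {n : ℕ} (hn : 0 < n) (hq1 : q ≠ 1)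
    (hq : IsPrimitiveRoot q n) [hpp : p.IsPrime] (ht : t hq1 hq ∉ p) (hs : s hq1 hq ∉ p) :
    (ext p).IsCompletelyPrime ↔
      IsField (E hq1 hq p) ∧ IsLeast (normDivisors hq1 hq p) n := by
  have := isScalarTower_k p
  have hp := algebraMap_k_eq_zero_iff (p := p)
  have ht' := mt (hp _).1 ht
  have hs' := mt (hp _).1 hs
  have := nontrivial_fibre hn hq1 hq hp
  have hq' : IsPrimitiveRoot (algebraMap K (k p) q) n :=
    hq.map_of_injective (algebraMap K (k p)).injective
  rw [ext_isCompletelyPrime_iff hn hq1 hq hp exists_fraction_k,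
    (isCyclicPair_fibre hq1 hq (F := k p)).noZeroDivisors_iff hn hq' ht' hs'
      (adjoin_fibre hn hq1 hq ht')]
  rfl

end FractionField

/-- The completely prime spectrum of `A₁(q)` at a primitive root of unity `q ≠ 1`. -/
theorem completelyPrimeSpectrum_eq {K : Type*} [Field K] {q : K} {n : ℕ} (hn : 0 < n) (hq1 : q ≠ 1)
    (hq : IsPrimitiveRoot q n) :
    completelyPrimeSpectrum (QuantumWeyl q) =
      {⊥, TwoSidedIdeal.span {QuantumWeyl.h q}} ∪
      {P | ∃ f : Polynomial K, f.Monic ∧ Irreducible f ∧ f ≠ Polynomial.X ∧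
        P = TwoSidedIdeal.span
          {QuantumWeyl.h q, Polynomial.aeval (QuantumWeyl.x q) f}} ∪
      {P | ∃ p : Ideal (QuantumWeyl.Z q), p.IsPrime ∧ p ≠ ⊥ ∧
        QuantumWeyl.t hq1 hq ∉ p ∧ QuantumWeyl.r hq1 hq ∉ p ∧ QuantumWeyl.s hq1 hq ∉ p ∧
        IsField (QuantumWeyl.E hq1 hq p) ∧
        IsLeast (QuantumWeyl.normDivisors hq1 hq p) n ∧
        P = QuantumWeyl.ext p} := by
  ext P
  change P.IsCompletelyPrime ↔ _
  constructor
  · intro hP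
    by_cases hh : h q ∈ P
    · rcases eq_span_of_h_mem hq1 hP hh with h1 | h1
      · exact Or.inl (Or.inl (Or.inr h1))
      · exact Or.inl (Or.inr h1)
    -- None of x, y, h lies in P, so neither do their powers, and t, r, s ∉ 𝔭. The fibre over 𝔭 is
    -- then a simple cyclic algebra and P = A₁𝔭; 𝔭 = 0 gives the zero ideal.
    · have hP' := (TwoSidedIdeal.isCompletelyPrime_iff P).1 hP
      have hpow : ∀ (u : QuantumWeyl q) (m : ℕ), u ∉ P → u ^ m ∉ P := by
        intro u m hu
        induction m with
        | zero => rw [pow_zero]; exact hP'.1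
        | succ m ih => exact fun h1 => (hP'.2 _ _ (pow_succ u m ▸ h1)).elim ih hu
      let p : Ideal (Z q) := P.asIdeal.comap (Subalgebra.center K (QuantumWeyl q)).val
      have hpP : ∀ z : Z q, z ∈ p ↔ z.1 ∈ P := fun z => Iff.rfl
      have hpp : p.IsPrime := by
        refine ⟨?_, fun {a b} hab => hP'.2 _ _ hab⟩
        rw [Ne, Ideal.eq_top_iff_one, hpP]
        exact hP'.1
      have ht : t hq1 hq ∉ p := hpow _ n (x_notMem hP'.1)
      have hr : r hq1 hq ∉ p := hpow _ n (y_notMem hP'.1)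
      have hs : s hq1 hq ∉ p := hpow _ n hh
      have := isScalarTower_k p
      have hp := algebraMap_k_eq_zero_iff (p := p)
      have hq' : IsPrimitiveRoot (algebraMap K (k p) q) n :=
        hq.map_of_injective (algebraMap K (k p)).injective
      have := nontrivial_fibre hn hq1 hq hp
      have hPe : P = ext p := eq_ext_of_isCompletelyPrime hn hq1 hq hp exists_fraction_k hpP
        ((isCyclicPair_fibre hq1 hq (F := k p)).isSimpleRing hn hq' (mt (hp _).1 ht)
          (mt (hp _).1 hs) (adjoin_fibre hn hq1 hq (mt (hp _).1 ht)))
      by_cases hp0 : p = ⊥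
      · refine Or.inl (Or.inl (Or.inl ?_))
        rw [hPe, hp0]
        ext u
        rw [QuantumWeyl.ext, Ideal.mem_toTwoSided, extLeft, Ideal.map_bot, Ideal.mem_bot,
          TwoSidedIdeal.mem_bot]
      · rw [hPe] at hP
        obtain ⟨hE, hl⟩ := (ext_isCompletelyPrime_iff_isLeast hn hq1 hq ht hs).1 hP
        exact Or.inr ⟨p, hpp, hp0, ht, hr, hs, hE, hl, hPe⟩
  · rintro (((rfl | rfl) | ⟨f, hm, hf, hX, rfl⟩) | ⟨p, hpp, -, ht, -, hs, hE, hl, rfl⟩)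
    · have := nontrivial q
      have := noZeroDivisors (hq.ne_zero hn.ne')
      rw [TwoSidedIdeal.isCompletelyPrime_iff]
      simp only [TwoSidedIdeal.mem_bot]
      exact ⟨one_ne_zero, fun a b => mul_eq_zero.1⟩
    · exact isCompletelyPrime_span_h hq1
    · exact isCompletelyPrime_span_h_irreducible hq1 hm hf hX
    · exact (ext_isCompletelyPrime_iff_isLeast hn hq1 hq ht hs).2 ⟨hE, hl⟩

end QuantumWeyl

theorem mainTheorem3 {K : Type*} [Field K] {q : K} {n : ℕ} (hn : 0 < n) (hq1 : q ≠ 1)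
    (hq : IsPrimitiveRoot q n) :
    completelyPrimeSpectrum (QuantumWeyl q) =
      {⊥, TwoSidedIdeal.span {QuantumWeyl.h q}} ∪
      {P | ∃ f : Polynomial K, f.Monic ∧ Irreducible f ∧ f ≠ Polynomial.X ∧
        P = TwoSidedIdeal.span
          {QuantumWeyl.h q, Polynomial.aeval (QuantumWeyl.x q) f}} ∪
      {P | ∃ p : Ideal (QuantumWeyl.Z q), p.IsPrime ∧ p ≠ ⊥ ∧
        QuantumWeyl.t hq1 hq ∉ p ∧ QuantumWeyl.r hq1 hq ∉ p ∧ QuantumWeyl.s hq1 hq ∉ p ∧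
        IsField (QuantumWeyl.E hq1 hq p) ∧
        IsLeast (QuantumWeyl.normDivisors hq1 hq p) n ∧
        P = QuantumWeyl.ext p} := by
  exact QuantumWeyl.completelyPrimeSpectrum_eq hn hq1 hq
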